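/- Let $0<\vartheta_1<1$ and $0<\vartheta_2<1$, and let $P,Q$ be real polynomials with $P(0)=Q(0)=0$. For an integer $q\ge 2$ put $L=\log q$, $y_1=q^{\vartheta_1}$, $y_2=q^{\vartheta_2}$, let $\mathscr C_q^+$ be the set of even primitive Dirichlet characters modulo $q$, and let $$\varphi^+(q)=\frac12\sum_{q=dr}\mu(d)\varphi(r),\qquad P[m]=P\Big(\frac{\log (y_1/m)}{\log y_1}\Big),\qquad Q[m]=Q\Big(\frac{\log (y_2/m)}{\log y_2}\Big).$$ For $\chi\in\mathscr C_q^+$ define $\psi(\chi)=\psi_1(\chi)+\psi_2(\chi)$, where $$\psi_1(\chi)=\sum_{m\le y_1}\frac{\mu(m)\chi(m)P[m]}{\sqrt m},\qquad \psi_2(\chi)=\frac1L\sum_{mn\le y_2}\frac{(\log*\mu)(m)\,\mu(n)\,\overline{\chi}(m)\,\chi(n)\,Q[mn]}{\sqrt{mn}},$$ the sums run over positive integers $m,n$, and $*$ is Dirichlet convolution. Then for every $\varepsilon>0$, $$\sum_{\chi\in\mathscr C_q^+}L(\tfrac12,\chi)\,\psi(\chi)=\varphi^+(q)\Big(P(1)+\frac{\vartheta_2}{2}Q_1(1)\Big)+O\big(qL^{-1+\varepsilon}\big),\qquad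 Q_1(x)=\int_0^xQ(u)\,du,$$ uniformly for all integers $q\ge2$, where the implied constant depends only on $\vartheta_1,\vartheta_2,P,Q$ and $\varepsilon$. -/

import Mathlib

open scoped BigOperators Polynomial ComplexConjugate

noncomputable section

namespace TwoPieceMollifier

/-- `𝒞_q⁺`: the finite set of even primitive Dirichlet characters modulo `q`. -/
def evenPrimitive (q : ℕ) [NeZero q] : Finset (DirichletCharacter ℂ q) :=
  open Classical in
  Finset.univ.filter fun χ : DirichletCharacter ℂ q => χ.IsPrimitive ∧ χ.Even

/-- `φ*(q) = ∑_{q = d r} μ(d) φ(r)`. -/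
def phiStar (q : ℕ) : ℝ :=
  ∑ d ∈ q.divisorsAntidiagonal, (ArithmeticFunction.moebius d.1 : ℝ) * (Nat.totient d.2 : ℝ)

/-- `φ⁺(q) = φ*(q) / 2`. -/
def phiPlus (q : ℕ) : ℝ := phiStar q / 2

/-- `P[m] = P(log (y / m) / log y)`. -/
def weight (P : ℝ[X]) (y : ℝ) (m : ℕ) : ℝ :=
  P.eval (Real.log (y / m) / Real.log y)

/-- The Dirichlet convolution `log * μ`. -/
def logConvMu : ArithmeticFunction ℝ :=
  ArithmeticFunction.log * (ArithmeticFunction.moebius : ArithmeticFunction ℝ)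

/-- The first piece, with `y₁ = q ^ ϑ₁`:
`ψ₁(χ) = ∑_{m ≤ y₁} μ(m) χ(m) P[m] / √m`. -/
def psi₁ (ϑ₁ : ℝ) (P : ℝ[X]) (q : ℕ) (χ : DirichletCharacter ℂ q) : ℂ :=
  ∑ m ∈ Finset.Icc 1 ⌊(q : ℝ) ^ ϑ₁⌋₊,
    (ArithmeticFunction.moebius m : ℂ) * χ m * (weight P ((q : ℝ) ^ ϑ₁) m : ℂ)
      / (Real.sqrt m : ℂ)

/-- The second piece, with `y₂ = q ^ ϑ₂`, the sum running over pairs of positive integers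
`m`, `n` with `m n ≤ y₂` (so that both are at most `⌊y₂⌋`):
`ψ₂(χ) = (log q)⁻¹ ∑_{m n ≤ y₂} (log * μ)(m) μ(n) χ̄(m) χ(n) Q[m n] / √(m n)`. -/
def psi₂ (ϑ₂ : ℝ) (Q : ℝ[X]) (q : ℕ) (χ : DirichletCharacter ℂ q) : ℂ :=
  (1 / (Real.log q : ℂ)) *
    ∑ p ∈ (Finset.Icc 1 ⌊(q : ℝ) ^ ϑ₂⌋₊ ×ˢ Finset.Icc 1 ⌊(q : ℝ) ^ ϑ₂⌋₊).filter
        (fun p : ℕ × ℕ => p.1 * p.2 ≤ ⌊(q : ℝ) ^ ϑ₂⌋₊),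
      (logConvMu p.1 : ℂ) * (ArithmeticFunction.moebius p.2 : ℂ) * conj (χ p.1) * χ p.2
        * (weight Q ((q : ℝ) ^ ϑ₂) (p.1 * p.2) : ℂ) / (Real.sqrt ((p.1 * p.2 : ℕ) : ℝ) : ℂ)

/-- The two-piece mollifier `ψ = ψ₁ + ψ₂`. -/
def psi (ϑ₁ ϑ₂ : ℝ) (P Q : ℝ[X]) (q : ℕ) (χ : DirichletCharacter ℂ q) : ℂ :=
  psi₁ ϑ₁ P q χ + psi₂ ϑ₂ Q q χ

/-- The mollified first moment `S₁(M)`: the sum of `L(1/2, χ) M(χ)` over `χ ∈ 𝒞_q⁺`. -/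
def S₁ (q : ℕ) [NeZero q] (M : DirichletCharacter ℂ q → ℂ) : ℂ :=
  ∑ χ ∈ evenPrimitive q, DirichletCharacter.LFunction χ (1 / 2) * M χ

/-- `Q₁(x) = ∫₀ˣ Q(u) du`. -/
def primitiveOf (Q : ℝ[X]) (x : ℝ) : ℝ := ∫ u in (0 : ℝ)..x, Q.eval u

end TwoPieceMollifier

end

namespace TwoPieceMollifier

/-! The moment is evaluated by orthogonality alone, with no functional equation. Since a nontrivial
`χ` sums to zero over a period, its Dirichlet series may be grouped into blocks of length `q` with a
constant subtracted in each. The grouped series still converges at `1/2` and gives `L(1/2, χ) = ∑_{l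
≤ q} χ(l) (l^{-1/2} + h(l))` with `|h(l)| ≤ q^{-1/2}` and `h` independent of `χ`
(`exists_LFunction_half_eq`).

Both pieces of the mollifier have the form `∑_{mn ≤ Y} c(m,n) χ̄(m) χ(n) / √(mn)` with bounded `c`
and `Y = ⌊q^ϑ⌋`. Orthogonality over even primitive characters turns the moment into sums over `ln ≡
±m (mod w)` for `w ∣ q`, with weight at most `w`. Outside `ln = m` such a congruence forces `max(ln,
m) ≥ w/2`, so summing over a residue class gains the full factor `1/w` and the off-diagonal part is
`O(q^η √(qY))`. The contribution of `h` to the diagonal obeys the same bound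
(`exists_norm_S₁_twisted_sub_le`). As `ϑ < 1`, this saves a power of `q`.

What remains is `φ⁺(q) ∑ c(m,n)/m` over `n ∣ m`, `(m,q) = 1`. In the first piece `m = 1` forces `n =
1`, leaving `P(1)`. In the second `log * μ = Λ`, and primes give `(log p / p)(Q[p] - Q[p²])`. By
Mertens and partial summation the two halves are `log y · Q₁(1)` and `log √y · Q₁(1)`, whose
difference over `L` is `(ϑ₂/2) Q₁(1)` (`exists_abs_diagonal_sub_le`). Higher prime powers cost
`O(1)`, and primes dividing `q` cost `O(1 + log(1 + L))`, which is why the error carries `L^ε`. -/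

/-! ### Orthogonality for even primitive characters -/

/-- With `q = c e`, the divisors `d` for which `c ∣ q / d` are exactly those of `e`. Taking `c` to
be a conductor, this expresses primitivity through factorisation of the character modulo the
divisors of `q`. -/
lemma sum_moebius_of_dvd {q c : ℕ} (hq : q ≠ 0) (hc : c ∣ q) :
    ∑ x ∈ q.divisorsAntidiagonal, (if c ∣ x.2 then ArithmeticFunction.moebius x.1 else 0)
      = if c = q then 1 else 0 := by
  obtain ⟨e, rfl⟩ := hc
  have hc0 : c ≠ 0 := by rintro rfl; simp at hq
  have he0 : e ≠ 0 := by rintro rfl; simp at hq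
  rw [Nat.sum_divisorsAntidiagonal
    (f := fun d r => if c ∣ r then ArithmeticFunction.moebius d else 0), ← Finset.sum_filter]
  have hset : (c * e).divisors.filter (fun d => c ∣ c * e / d) = e.divisors := by
    ext d
    simp only [Finset.mem_filter, Nat.mem_divisors]
    constructor
    · rintro ⟨⟨hd, _⟩, k, hk⟩
      refine ⟨?_, he0⟩
      have := Nat.mul_div_cancel' hd
      rw [hk] at this
      exact ⟨k, by
        apply Nat.eq_of_mul_eq_mul_left (Nat.pos_of_ne_zero hc0)
        rw [← this]; ring⟩
    · rintro ⟨⟨k, rfl⟩, _⟩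
      have hd0 : 0 < d := Nat.pos_of_ne_zero (by rintro rfl; simp at he0)
      refine ⟨⟨⟨c * k, by ring⟩, hq⟩, ⟨k, ?_⟩⟩
      rw [show c * (d * k) = d * (c * k) by ring, Nat.mul_div_cancel_left _ hd0]
  rw [hset, ← ArithmeticFunction.coe_mul_zeta_apply, ArithmeticFunction.moebius_mul_coe_zeta,
    ArithmeticFunction.one_apply]
  have : e = 1 ↔ c = c * e := by
    constructor
    · rintro rfl; simp
    · intro h
      apply Nat.eq_of_mul_eq_mul_left (Nat.pos_of_ne_zero hc0)
      rw [← h, mul_one]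
  simp [this]

open Classical in
-- Since `changeLevel` is injective, these characters are a copy of all characters modulo `w`, for
-- which ordinary orthogonality is available.
lemma sum_factorsThrough {q w : ℕ} [NeZero q] (hw : w ∣ q) (a : (ZMod q)ˣ) :
    ∑ χ : DirichletCharacter ℂ q, (if χ.FactorsThrough w then χ a else 0)
      = if ZMod.unitsMap hw a = 1 then (w.totient : ℂ) else 0 := by
  have : NeZero w := ⟨by rintro rfl; simp at hw; exact NeZero.ne q hw⟩
  rw [← Finset.sum_filter]
  have himg : (Finset.univ : Finset (DirichletCharacter ℂ q)).filter (·.FactorsThrough w)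
      = (Finset.univ : Finset (DirichletCharacter ℂ w)).image
          (DirichletCharacter.changeLevel hw) := by
    ext χ
    simp only [Finset.mem_filter, Finset.mem_univ, true_and, Finset.mem_image]
    constructor
    · rintro ⟨_, ψ, h⟩
      exact ⟨ψ, h.symm⟩
    · rintro ⟨ψ, h⟩
      exact ⟨hw, ψ, h.symm⟩
  rw [himg, Finset.sum_image (fun _ _ _ _ h => DirichletCharacter.changeLevel_injective hw h)]
  simp_rw [DirichletCharacter.changeLevel_eq_cast_of_dvd, ← ZMod.unitsMap_val hw a]
  rw [DirichletCharacter.sum_characters_eq]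
  simp

open Classical in
lemma sum_isPrimitive {q : ℕ} [NeZero q] (a : (ZMod q)ˣ) :
    ∑ χ : DirichletCharacter ℂ q, (if χ.IsPrimitive then χ a else 0)
      = ∑ x ∈ q.divisorsAntidiagonal, (ArithmeticFunction.moebius x.1 : ℂ) *
          if ((a : ZMod q).cast : ZMod x.2) = 1 then (x.2.totient : ℂ) else 0 := by
  have hχ (χ : DirichletCharacter ℂ q) : (if χ.IsPrimitive then χ a else 0)
      = ∑ x ∈ q.divisorsAntidiagonal, (ArithmeticFunction.moebius x.1 : ℂ) *
          (if χ.FactorsThrough x.2 then χ a else 0) := by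
    have h := sum_moebius_of_dvd (NeZero.ne q) χ.conductor_dvd_level
    have h2 : (if χ.IsPrimitive then χ a else 0)
        = ((if χ.conductor = q then 1 else 0 : ℤ) : ℂ) * χ a := by
      rw [DirichletCharacter.isPrimitive_def]
      split_ifs <;> simp
    rw [h2, ← h, Int.cast_sum, Finset.sum_mul]
    refine Finset.sum_congr rfl fun x hx => ?_
    have hx2 : x.2 ∣ q := ⟨x.1, by rw [← (Nat.mem_divisorsAntidiagonal.1 hx).1, mul_comm]⟩
    have := χ.mem_conductorSet_iff_conductor_dvd hx2
    rw [DirichletCharacter.mem_conductorSet_iff] at this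
    rw [this]
    split_ifs <;> simp
  simp_rw [hχ]
  rw [Finset.sum_comm]
  refine Finset.sum_congr rfl fun x hx => ?_
  have hx2 : x.2 ∣ q := ⟨x.1, by rw [← (Nat.mem_divisorsAntidiagonal.1 hx).1, mul_comm]⟩
  rw [← Finset.mul_sum, sum_factorsThrough hx2]
  congr 1
  simp only [← ZMod.unitsMap_val hx2 a, Units.val_eq_one]

/-- Orthogonality relation for even primitive characters. -/
lemma sum_evenPrimitive_unit {q : ℕ} [NeZero q] (a : (ZMod q)ˣ) :
    ∑ χ ∈ evenPrimitive q, χ a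
      = ∑ x ∈ q.divisorsAntidiagonal, (ArithmeticFunction.moebius x.1 : ℂ) * (x.2.totient : ℂ) / 2 *
          ((if ((a : ZMod q).cast : ZMod x.2) = 1 then 1 else 0)
            + if ((a : ZMod q).cast : ZMod x.2) = -1 then 1 else 0) := by
  classical
  -- Evenness is detected by averaging the values at `a` and `-a`.
  have h1 : ∑ χ ∈ evenPrimitive q, χ a = (1 / 2 : ℂ) *
      (∑ χ : DirichletCharacter ℂ q, (if χ.IsPrimitive then χ a else 0)
        + ∑ χ : DirichletCharacter ℂ q, (if χ.IsPrimitive then χ ((-a : (ZMod q)ˣ) : ZMod q)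
            else 0)) := by
    rw [← Finset.sum_add_distrib, Finset.mul_sum, evenPrimitive, Finset.sum_filter]
    refine Finset.sum_congr rfl fun χ _ => ?_
    by_cases hp : χ.IsPrimitive
    · rcases χ.even_or_odd with he | ho
      · simp only [hp, he, and_self, if_true, Units.val_neg, he.eval_neg]
        ring
      · have hne : ¬ χ.Even := ho.not_even
        simp only [hp, hne, and_false, if_true, if_false, Units.val_neg, ho.eval_neg]
        ring
    · simp [hp]
  rw [h1, sum_isPrimitive, sum_isPrimitive, ← Finset.sum_add_distrib, Finset.mul_sum]
  refine Finset.sum_congr rfl fun x hx => ?_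
  have hx2 : x.2 ∣ q := ⟨x.1, by rw [← (Nat.mem_divisorsAntidiagonal.1 hx).1, mul_comm]⟩
  have hneg : (((-a : (ZMod q)ˣ) : ZMod q).cast : ZMod x.2) = 1 ↔
      ((a : ZMod q).cast : ZMod x.2) = -1 := by
    rw [Units.val_neg, ZMod.cast_neg hx2, neg_eq_iff_eq_neg]
  simp only [hneg]
  split_ifs <;> ring

lemma conj_apply_unit {q : ℕ} [NeZero q] (χ : DirichletCharacter ℂ q) (u : (ZMod q)ˣ) :
    conj (χ u) = χ (u⁻¹ : (ZMod q)ˣ) := by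
  rw [starRingEnd_apply, MulChar.star_apply', MulChar.inv_apply, Ring.inverse_unit]

lemma sum_evenPrimitive {q : ℕ} [NeZero q] {m N : ℕ} (hm : m.Coprime q) (hN : N.Coprime q) :
    ∑ χ ∈ evenPrimitive q, conj (χ m) * χ N
      = ∑ x ∈ q.divisorsAntidiagonal, (ArithmeticFunction.moebius x.1 : ℂ) * (x.2.totient : ℂ) / 2 *
          ((if (N : ZMod x.2) = m then 1 else 0) + if (N : ZMod x.2) = -m then 1 else 0) := by
  set u := ZMod.unitOfCoprime m hm
  set v := ZMod.unitOfCoprime N hN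
  have hu : (u : ZMod q) = m := rfl
  have hv : (v : ZMod q) = N := rfl
  have h1 (χ : DirichletCharacter ℂ q) :
      conj (χ m) * χ N = χ ((u⁻¹ * v : (ZMod q)ˣ) : ZMod q) := by
    rw [← hu, ← hv, conj_apply_unit, ← map_mul, Units.val_mul]
  simp_rw [h1]
  rw [sum_evenPrimitive_unit]
  refine Finset.sum_congr rfl fun x hx => ?_
  have hx2 : x.2 ∣ q := ⟨x.1, by rw [← (Nat.mem_divisorsAntidiagonal.1 hx).1, mul_comm]⟩
  have hval : ((((u⁻¹ * v : (ZMod q)ˣ) : ZMod q).cast : ZMod x.2))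
      = ((ZMod.unitsMap hx2 u)⁻¹ * ZMod.unitsMap hx2 v : (ZMod x.2)ˣ) := by
    rw [← map_inv, ← map_mul, ZMod.unitsMap_val]
  have hu' : ((ZMod.unitsMap hx2 u : (ZMod x.2)ˣ) : ZMod x.2) = m := by
    rw [ZMod.unitsMap_val, hu, ZMod.cast_natCast hx2]
  have hv' : ((ZMod.unitsMap hx2 v : (ZMod x.2)ˣ) : ZMod x.2) = N := by
    rw [ZMod.unitsMap_val, hv, ZMod.cast_natCast hx2]
  have e1 : ((((u⁻¹ * v : (ZMod q)ˣ) : ZMod q).cast : ZMod x.2)) = 1 ↔ (N : ZMod x.2) = m := by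
    rw [hval, Units.val_eq_one, inv_mul_eq_one, ← Units.val_inj, hu', hv', eq_comm]
  have e2 : ((((u⁻¹ * v : (ZMod q)ˣ) : ZMod q).cast : ZMod x.2)) = -1 ↔
      (N : ZMod x.2) = -m := by
    rw [hval, ← hu', ← hv', Units.val_mul, Units.inv_mul_eq_iff_eq_mul, mul_neg, mul_one]
  simp only [e1, e2]

lemma phiStar_eq {q : ℕ} [NeZero q] : (phiStar q : ℂ) =
    ∑ x ∈ q.divisorsAntidiagonal, (ArithmeticFunction.moebius x.1 : ℂ) * (x.2.totient : ℂ) := by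
  simp [phiStar]

/-- Orthogonality at the unit `1` shows that `phiStar q` counts the primitive characters, which are
among the `φ(q)` characters modulo `q`. -/
lemma abs_phiStar_le (q : ℕ) [NeZero q] : |phiStar q| ≤ q := by
  classical
  have h := sum_isPrimitive (q := q) 1
  have h1 : (phiStar q : ℂ)
      = ∑ χ : DirichletCharacter ℂ q, (if χ.IsPrimitive then (1 : ℂ) else 0) := by
    rw [phiStar_eq]
    refine Eq.trans ?_ (h.symm.trans ?_)
    · refine Finset.sum_congr rfl fun x hx => ?_
      have hx2 : x.2 ∣ q := ⟨x.1, by rw [← (Nat.mem_divisorsAntidiagonal.1 hx).1, mul_comm]⟩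
      rw [Units.val_one, ZMod.cast_one hx2, if_pos rfl]
    · simp
  rw [Finset.sum_boole] at h1
  have h2 : phiStar q = ((Finset.univ.filter
      fun χ : DirichletCharacter ℂ q => χ.IsPrimitive).card : ℝ) := by exact_mod_cast h1
  rw [h2, abs_of_nonneg (Nat.cast_nonneg _)]
  have h3 : (Finset.univ.filter fun χ : DirichletCharacter ℂ q => χ.IsPrimitive).card
      ≤ q.totient := by
    rw [← DirichletCharacter.card_eq_totient_of_hasEnoughRootsOfUnity ℂ q, Nat.card_eq_fintype_card]
    exact Finset.card_le_univ _
  exact_mod_cast h3.trans (Nat.totient_le q)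

/-! ### The central value as a finite character sum -/

lemma norm_cpow_neg_sub_le {x y : ℝ} (hx : 0 < x) (hxy : x ≤ y) {s : ℂ} (hs : 0 < s.re) :
    ‖(x : ℂ) ^ (-s) - (y : ℂ) ^ (-s)‖ ≤ ‖s‖ * x ^ (-s.re - 1) * (y - x) := by
  have hd : ∀ t ∈ Set.Icc x y, HasDerivWithinAt (fun t : ℝ => (t : ℂ) ^ (-s))
      (-s * (t : ℂ) ^ (-s - 1)) (Set.Icc x y) t := by
    intro t ht
    have ht0 : 0 < t := hx.trans_le ht.1
    have h := ((hasDerivAt_id (t : ℂ)).cpow_const (c := -s) (Or.inl (by simpa using ht0)))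
    simpa using h.comp_ofReal.hasDerivWithinAt
  have hb : ∀ t ∈ Set.Icc x y, ‖-s * (t : ℂ) ^ (-s - 1)‖ ≤ ‖s‖ * x ^ (-s.re - 1) := by
    intro t ht
    have ht0 : 0 < t := hx.trans_le ht.1
    rw [norm_mul, norm_neg, Complex.norm_cpow_eq_rpow_re_of_pos ht0]
    gcongr
    simpa using Real.rpow_le_rpow_of_nonpos hx ht.1 (by linarith : -s.re - 1 ≤ 0)
  have := (convex_Icc x y).norm_image_sub_le_of_norm_hasDerivWithin_le hd hb
    (Set.right_mem_Icc.2 hxy) (Set.left_mem_Icc.2 hxy)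
  rwa [Real.norm_eq_abs, abs_of_nonpos (by linarith), neg_sub] at this

lemma sum_range_mul_eq {M : Type*} [AddCommMonoid M] (f : ℕ → M) (q K : ℕ) :
    ∑ n ∈ Finset.range (K * q), f n
      = ∑ k ∈ Finset.range K, ∑ a ∈ Finset.range q, f (k * q + a) := by
  induction K with
  | zero => simp
  | succ K ih => rw [Finset.sum_range_succ, ← ih, add_mul, one_mul, Finset.sum_range_add]

lemma sum_range_character_eq_zero {q : ℕ} [NeZero q] {χ : DirichletCharacter ℂ q} (hχ : χ ≠ 1) :
    ∑ a ∈ Finset.range q, χ ((a + 1 : ℕ) : ZMod q) = 0 := by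
  have h := MulChar.sum_eq_zero_of_ne_one hχ
  have h1 : ∑ a ∈ Finset.range q, χ ((a : ℕ) : ZMod q) = 0 := by
    rw [← h]
    refine Finset.sum_bij (fun a _ => (a : ZMod q)) (by simp) ?_ ?_ (by simp)
    · intro a ha b hb hab
      rw [ZMod.natCast_eq_natCast_iff] at hab
      rw [Finset.mem_range] at ha hb
      exact Nat.ModEq.eq_of_lt_of_lt hab ha hb
    · intro b _
      exact ⟨b.val, Finset.mem_range.2 (ZMod.val_lt b), ZMod.natCast_zmod_val b⟩
  have h2 := Finset.sum_range_succ (fun a : ℕ => χ (a : ZMod q)) q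
  rw [Finset.sum_range_succ', h1] at h2
  simpa using h2

/-- The blocks of length `q` of the Dirichlet series of `χ`, with a constant subtracted. -/
noncomputable def blockTerm {q : ℕ} (χ : DirichletCharacter ℂ q) (k : ℕ) (s : ℂ) : ℂ :=
  ∑ a ∈ Finset.range q, χ ((a + 1 : ℕ) : ZMod q) *
    ((((k * q + (a + 1) : ℕ) : ℝ) : ℂ) ^ (-s) - (((k * q + q : ℕ) : ℝ) : ℂ) ^ (-s))

/-- Within a block the arguments differ by at most `q`, so the mean value bound gains one power of
`k + 1`. With `Re s > 1/4` the exponent is below `-5/4`, which is summable uniformly in `s`. -/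
lemma norm_blockTerm_le {q : ℕ} (χ : DirichletCharacter ℂ q) (k : ℕ) {s : ℂ}
    (hs : 1 / 4 < s.re) (hs' : ‖s‖ < 10) :
    ‖blockTerm χ k s‖ ≤ q * (10 * q * ((k : ℝ) + 1) ^ (-(5 / 4) : ℝ)) := by
  rw [blockTerm]
  refine (norm_sum_le _ _).trans ?_
  have : ∀ a ∈ Finset.range q, ‖χ ((a + 1 : ℕ) : ZMod q) *
    ((((k * q + (a + 1) : ℕ) : ℝ) : ℂ) ^ (-s) - (((k * q + q : ℕ) : ℝ) : ℂ) ^ (-s))‖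
      ≤ 10 * q * ((k : ℝ) + 1) ^ (-(5 / 4) : ℝ) := by
    intro a ha
    rw [Finset.mem_range] at ha
    have hk1 : (k : ℝ) + 1 ≤ ((k * q + (a + 1) : ℕ) : ℝ) := by
      have : k * 1 ≤ k * q := Nat.mul_le_mul_left k (by omega)
      exact_mod_cast (by omega : k + 1 ≤ k * q + (a + 1))
    have hpos : (0 : ℝ) < ((k * q + (a + 1) : ℕ) : ℝ) := by positivity
    have hle : ((k * q + (a + 1) : ℕ) : ℝ) ≤ ((k * q + q : ℕ) : ℝ) := by
      exact_mod_cast (by omega : k * q + (a + 1) ≤ k * q + q)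
    have h := norm_cpow_neg_sub_le hpos hle (s := s) (by linarith)
    rw [norm_mul]
    have hr : ((k * q + (a + 1) : ℕ) : ℝ) ^ (-s.re - 1) ≤ ((k : ℝ) + 1) ^ (-(5 / 4) : ℝ) :=
      (Real.rpow_le_rpow_of_nonpos (by positivity) hk1 (by linarith)).trans
        (Real.rpow_le_rpow_of_exponent_le (by linarith [(Nat.cast_nonneg k : (0 : ℝ) ≤ k)])
          (by linarith))
    have hsub : ((k * q + q : ℕ) : ℝ) - ((k * q + (a + 1) : ℕ) : ℝ) ≤ q := by
      push_cast
      linarith [(Nat.cast_nonneg a : (0 : ℝ) ≤ a)]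
    calc _ ≤ 1 * (‖s‖ * ((k * q + (a + 1) : ℕ) : ℝ) ^ (-s.re - 1) *
          (((k * q + q : ℕ) : ℝ) - ((k * q + (a + 1) : ℕ) : ℝ))) := by
          gcongr
          exact DirichletCharacter.norm_le_one χ _
      _ ≤ 1 * (10 * ((k : ℝ) + 1) ^ (-(5 / 4) : ℝ) * q) := by
          have : 0 ≤ ((k * q + q : ℕ) : ℝ) - ((k * q + (a + 1) : ℕ) : ℝ) := by linarith
          gcongr
      _ = _ := by ring
  refine (Finset.sum_le_sum this).trans ?_
  simp

lemma summable_blockTerm_bound (q : ℕ) :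
    Summable fun k : ℕ => (q : ℝ) * (10 * q * ((k : ℝ) + 1) ^ (-(5 / 4) : ℝ)) := by
  refine Summable.mul_left _ (Summable.mul_left _ ?_)
  have := (Real.summable_nat_rpow (p := -(5 / 4))).2 (by norm_num)
  have h := (summable_nat_add_iff 1).2 this
  simpa using h

lemma differentiableAt_blockTerm {q : ℕ} (χ : DirichletCharacter ℂ q) (k : ℕ) (s : ℂ) :
    DifferentiableAt ℂ (blockTerm χ k) s := by
  unfold blockTerm
  refine DifferentiableAt.fun_sum fun a ha => ?_
  have hq : 0 < q := lt_of_le_of_lt (Nat.zero_le _) (Finset.mem_range.1 ha)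
  refine DifferentiableAt.const_mul (DifferentiableAt.sub ?_ ?_) _
  · exact differentiableAt_id.neg.const_cpow
      (Or.inl (by exact_mod_cast (by omega : k * q + (a + 1) ≠ 0)))
  · exact differentiableAt_id.neg.const_cpow
      (Or.inl (by exact_mod_cast (by omega : k * q + q ≠ 0)))

lemma LFunction_eq_tsum_blockTerm_of_one_lt {q : ℕ} [NeZero q] {χ : DirichletCharacter ℂ q}
    (hχ : χ ≠ 1) {s : ℂ} (hs : 1 < s.re) (hs' : ‖s‖ < 10) :
    DirichletCharacter.LFunction χ s = ∑' k, blockTerm χ k s := by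
  rw [DirichletCharacter.LFunction_eq_LSeries χ hs]
  have hsum : Summable fun k => blockTerm χ k s :=
    Summable.of_norm_bounded (summable_blockTerm_bound q)
      fun k => norm_blockTerm_le χ k (by linarith) hs'
  have h1 := hsum.hasSum.tendsto_sum_nat
  have h2 := (DirichletCharacter.LSeriesSummable_of_one_lt_re χ hs).hasSum.tendsto_sum_nat
  have hq : 0 < q := Nat.pos_of_ne_zero (NeZero.ne q)
  -- The extra `1` accounts for the zero term at `n = 0`: blocks cover `1, …, K q`.
  have hK : Filter.Tendsto (fun K : ℕ => K * q + 1) Filter.atTop Filter.atTop :=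
    Filter.tendsto_atTop_mono
      (fun K => (Nat.le_mul_of_pos_right K hq).trans (Nat.le_succ _)) Filter.tendsto_id
  have h3 := h2.comp hK
  refine tendsto_nhds_unique h3 (h1.congr fun K => ?_)
  rw [Function.comp_apply, Finset.sum_range_succ', LSeries.term_zero, add_zero, sum_range_mul_eq]
  refine Finset.sum_congr rfl fun k _ => ?_
  rw [blockTerm]
  simp_rw [mul_sub]
  rw [Finset.sum_sub_distrib, ← Finset.sum_mul, sum_range_character_eq_zero hχ, zero_mul, sub_zero]
  refine Finset.sum_congr rfl fun a _ => ?_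
  rw [LSeries.term_of_ne_zero (by omega), Complex.cpow_neg, div_eq_mul_inv, ← add_assoc]
  congr 2
  push_cast
  simp

lemma LFunction_eq_tsum_blockTerm {q : ℕ} [NeZero q] {χ : DirichletCharacter ℂ q}
    (hχ : χ ≠ 1) : DirichletCharacter.LFunction χ (1 / 2) = ∑' k, blockTerm χ k (1 / 2) := by
  -- The identity theorem is applied on a convex set containing both `1/2` and `2`. The disc only
  -- keeps `‖s‖` bounded, so that the block bound is uniform.
  set U : Set ℂ := {s | 1 / 4 < s.re} ∩ Metric.ball 0 10
  have hUo : IsOpen U := (isOpen_lt continuous_const Complex.continuous_re).inter Metric.isOpen_ball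
  have hUc : IsPreconnected U :=
    ((convex_halfSpace_re_gt (1 / 4)).inter (convex_ball 0 10)).isPreconnected
  have hU (s : ℂ) : s ∈ U ↔ 1 / 4 < s.re ∧ ‖s‖ < 10 := by simp [U]
  have hF : DifferentiableOn ℂ (fun s => ∑' k, blockTerm χ k s) U :=
    Complex.differentiableOn_tsum_of_summable_norm (summable_blockTerm_bound q)
      (fun k s _ => (differentiableAt_blockTerm χ k s).differentiableWithinAt) hUo
      (fun k s hs => norm_blockTerm_le χ k ((hU s).1 hs).1 ((hU s).1 hs).2)
  have hL : DifferentiableOn ℂ (DirichletCharacter.LFunction χ) U :=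
    (DirichletCharacter.differentiable_LFunction hχ).differentiableOn
  refine (hL.analyticOnNhd hUo).eqOn_of_preconnected_of_eventuallyEq (hF.analyticOnNhd hUo) hUc
    (z₀ := 2) ((hU 2).2 (by norm_num)) ?_ ((hU _).2 (by norm_num))
  have hV : IsOpen ({s : ℂ | 1 < s.re} ∩ Metric.ball 0 10) :=
    (isOpen_lt continuous_const Complex.continuous_re).inter Metric.isOpen_ball
  filter_upwards [hV.mem_nhds (by norm_num : (2 : ℂ) ∈ {s : ℂ | 1 < s.re} ∩ Metric.ball 0 10)] with s hs
  exact LFunction_eq_tsum_blockTerm_of_one_lt hχ hs.1 (by simpa using hs.2)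

lemma natCast_cpow_neg_half (n : ℕ) :
    (((n : ℕ) : ℝ) : ℂ) ^ (-(1 / 2) : ℂ) = ((1 / √(n : ℝ) : ℝ) : ℂ) := by
  rw [Real.sqrt_eq_rpow, one_div ((n : ℝ) ^ (1 / 2 : ℝ)), ← Real.rpow_neg (Nat.cast_nonneg n),
    Complex.ofReal_cpow (Nat.cast_nonneg n)]
  norm_num

lemma one_div_sqrt_anti {m n : ℕ} (hm : 0 < m) (h : m ≤ n) :
    1 / √(n : ℝ) ≤ 1 / √(m : ℝ) := by
  have : (0 : ℝ) < m := by exact_mod_cast hm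
  have h' : (m : ℝ) ≤ n := by exact_mod_cast h
  gcongr

/-- The central value as a finite sum with smooth real weights independent of the character. -/
lemma exists_LFunction_half_eq (q : ℕ) [NeZero q] :
    ∃ h : ℕ → ℝ, (∀ l ∈ Finset.Icc 1 q, |h l| ≤ 1 / √(q : ℝ)) ∧
      ∀ χ : DirichletCharacter ℂ q, χ ≠ 1 → DirichletCharacter.LFunction χ (1 / 2)
        = ∑ l ∈ Finset.Icc 1 q, χ l * ((1 / √(l : ℝ) + h l : ℝ) : ℂ) := by
  have hq : 0 < q := Nat.pos_of_ne_zero (NeZero.ne q)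
  set D : ℕ → ℕ → ℝ := fun l k => 1 / √((k * q + l : ℕ) : ℝ) - 1 / √((k * q + q : ℕ) : ℝ) with hD
  have hD0 : ∀ l ∈ Finset.Icc 1 q, ∀ k, 0 ≤ D l k := by
    intro l hl k
    rw [Finset.mem_Icc] at hl
    exact sub_nonneg.2 (one_div_sqrt_anti (by omega) (by omega))
  -- Replacing `l` by `0` in block `k + 1` moves the first argument back to the end of block `k`,
  -- and the sum telescopes.
  have hDpart : ∀ l ∈ Finset.Icc 1 q, ∀ n, ∑ k ∈ Finset.range n, D l (k + 1) ≤ 1 / √(q : ℝ) := by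
    intro l hl n
    rw [Finset.mem_Icc] at hl
    calc ∑ k ∈ Finset.range n, D l (k + 1)
        ≤ ∑ k ∈ Finset.range n,
          (1 / √((k * q + q : ℕ) : ℝ) - 1 / √(((k + 1) * q + q : ℕ) : ℝ)) := by
          refine Finset.sum_le_sum fun k _ => ?_
          rw [hD]
          refine sub_le_sub_right (one_div_sqrt_anti (by omega) ?_) _
          rw [add_mul]; omega
      _ = 1 / √(q : ℝ) - 1 / √((n * q + q : ℕ) : ℝ) := by
          rw [Finset.sum_range_sub' (fun k => 1 / √((k * q + q : ℕ) : ℝ))]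
          simp
      _ ≤ _ := sub_le_self _ (by positivity)
  have hsum' : ∀ l ∈ Finset.Icc 1 q, Summable fun k => D l (k + 1) := fun l hl =>
    summable_of_sum_range_le (fun k => hD0 l hl _) (hDpart l hl)
  have hsum : ∀ l ∈ Finset.Icc 1 q, Summable (D l) := fun l hl =>
    (summable_nat_add_iff 1).1 (hsum' l hl)
  -- Here `h` collects the blocks after the first, minus the constant subtracted in the first. Both
  -- quantities lie in `[0, q^{-1/2}]`.
  refine ⟨fun l => ∑' k, D l (k + 1) - 1 / √(q : ℝ), fun l hl => ?_, fun χ hχ => ?_⟩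
  · have h1 : 0 ≤ ∑' k, D l (k + 1) := tsum_nonneg fun k => hD0 l hl _
    have h2 : ∑' k, D l (k + 1) ≤ 1 / √(q : ℝ) :=
      Real.tsum_le_of_sum_range_le (fun k => hD0 l hl _) (hDpart l hl)
    have h3 : 0 ≤ 1 / √(q : ℝ) := by positivity
    rw [abs_le]
    constructor <;> linarith
  · have hblock (k : ℕ) : blockTerm χ k (1 / 2) = ∑ l ∈ Finset.Icc 1 q, χ l * ((D l k : ℝ) : ℂ) := by
      rw [blockTerm, Finset.range_eq_Ico,
        Finset.sum_Ico_add' (fun l : ℕ => χ (l : ZMod q) * ((((k * q + l : ℕ) : ℝ) : ℂ) ^ (-(1/2) : ℂ)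
          - (((k * q + q : ℕ) : ℝ) : ℂ) ^ (-(1/2) : ℂ))) 0 q 1]
      refine Finset.sum_congr (by ext; simp) fun l _ => ?_
      rw [natCast_cpow_neg_half, natCast_cpow_neg_half, hD]
      push_cast
      rfl
    rw [LFunction_eq_tsum_blockTerm hχ]
    simp_rw [hblock]
    have hs : ∀ l ∈ Finset.Icc 1 q, Summable fun k => χ l * ((D l k : ℝ) : ℂ) := fun l hl =>
      (Complex.summable_ofReal.2 (hsum l hl)).mul_left _
    rw [Summable.tsum_finsetSum hs]
    refine Finset.sum_congr rfl fun l hl => ?_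
    rw [tsum_mul_left, ← Complex.ofReal_tsum, (hsum l hl).tsum_eq_zero_add]
    congr 2
    simp only [hD, zero_mul, zero_add]
    ring

/-! ### The divisor bound and elementary sums -/

lemma one_add_le_rpow {p : ℕ} (hp : 2 ≤ p) {ε : ℝ} (a : ℕ) :
    1 + a * (ε * Real.log p) ≤ ((p : ℝ) ^ a) ^ ε := by
  have hp0 : (0 : ℝ) < p := by exact_mod_cast (by omega : 0 < p)
  rw [Real.rpow_def_of_pos (by positivity), Real.log_pow, add_comm]
  refine le_trans (le_of_eq ?_) (Real.add_one_le_exp _)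
  ring

/-- The divisor bound. -/
lemma exists_card_divisors_le {ε : ℝ} (hε : 0 < ε) :
    ∃ C : ℝ, 0 < C ∧ ∀ n : ℕ, (n.divisors.card : ℝ) ≤ C * (n : ℝ) ^ ε := by
  -- Primes `p ≥ e^{1/ε}` satisfy `ε log p ≥ 1`, so `a + 1 ≤ p^{aε}` without loss. Each of the fewer
  -- than `P + 1` smaller primes loses at most `K`, chosen so that `K ε log p ≥ 1`.
  set K : ℝ := max 1 (1 / (ε * Real.log 2)) with hK
  set P : ℕ := ⌈Real.exp (1 / ε)⌉₊ with hP
  have hK1 : 1 ≤ K := le_max_left _ _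
  have hlog2 : 0 < Real.log 2 := Real.log_pos (by norm_num)
  refine ⟨K ^ P, by positivity, fun n => ?_⟩
  rcases eq_or_ne n 0 with rfl | hn
  · simp only [Nat.divisors_zero, Finset.card_empty, Nat.cast_zero]
    positivity
  have hlocal : ∀ p ∈ n.primeFactors, ((n.factorization p + 1 : ℕ) : ℝ)
      ≤ (if p < P then K else 1) * ((p : ℝ) ^ n.factorization p) ^ ε := by
    intro p hp
    have hp2 := (Nat.prime_of_mem_primeFactors hp).two_le
    have hp2' : (2 : ℝ) ≤ p := by exact_mod_cast hp2
    set a := n.factorization p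
    have h := one_add_le_rpow hp2 (ε := ε) a
    have ha : (0 : ℝ) ≤ a := Nat.cast_nonneg a
    split_ifs with hlt
    · have hk2 : 1 ≤ K * (ε * Real.log p) := by
        calc 1 = 1 / (ε * Real.log 2) * (ε * Real.log 2) := by field_simp
          _ ≤ K * (ε * Real.log p) := by
            gcongr
            exact le_max_right _ _
      calc ((a + 1 : ℕ) : ℝ) = 1 + a * 1 := by push_cast; ring
        _ ≤ K + a * (K * (ε * Real.log p)) := by gcongr
        _ = K * (1 + a * (ε * Real.log p)) := by ring
        _ ≤ _ := by gcongr
    · have hpP : Real.exp (1 / ε) ≤ p := (Nat.le_ceil _).trans (by exact_mod_cast not_lt.1 hlt)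
      have hl : 1 / ε ≤ Real.log p := (Real.le_log_iff_exp_le (by linarith)).2 hpP
      have hl' : 1 ≤ ε * Real.log p := by
        rw [div_le_iff₀ hε] at hl
        linarith
      calc ((a + 1 : ℕ) : ℝ) = 1 + a * 1 := by push_cast; ring
        _ ≤ 1 + a * (ε * Real.log p) := by gcongr
        _ ≤ _ := by rw [one_mul]; exact h
  have hprod : (n : ℝ) = ∏ p ∈ n.primeFactors, (p : ℝ) ^ n.factorization p := by
    conv_lhs => rw [← Nat.prod_factorization_pow_eq_self hn, Nat.prod_factorization_eq_prod_primeFactors]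
    push_cast
    rfl
  rw [Nat.card_divisors hn, Nat.cast_prod]
  calc _ ≤ ∏ p ∈ n.primeFactors,
        (if p < P then K else 1) * ((p : ℝ) ^ n.factorization p) ^ ε :=
        Finset.prod_le_prod (fun _ _ => Nat.cast_nonneg _) hlocal
    _ = K ^ (n.primeFactors.filter (· < P)).card * (n : ℝ) ^ ε := by
        rw [Finset.prod_mul_distrib, Real.finsetProd_rpow _ _ (fun _ _ => by positivity), ← hprod,
          ← Finset.prod_filter, Finset.prod_const]
    _ ≤ K ^ P * (n : ℝ) ^ ε := by
        gcongr
        calc _ ≤ (Finset.range P).card := Finset.card_le_card fun p hp => by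
                simpa using (Finset.mem_filter.1 hp).2
            _ = P := Finset.card_range P

lemma sum_one_div_sqrt_le (K : ℕ) : ∑ k ∈ Finset.Icc 1 K, 1 / √(k : ℝ) ≤ 2 * √(K : ℝ) := by
  induction K with
  | zero => simp
  | succ K ih =>
    rw [Finset.sum_Icc_succ_top (by omega)]
    have h1 : 0 < √((K + 1 : ℕ) : ℝ) := Real.sqrt_pos.2 (by positivity)
    have h2 : √((K + 1 : ℕ) : ℝ) ^ 2 = K + 1 := by rw [Real.sq_sqrt (by positivity)]; push_cast; ring
    have h3 : √(K : ℝ) ^ 2 = K := Real.sq_sqrt (by positivity)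
    have h4 : 1 / √((K + 1 : ℕ) : ℝ) ≤ 2 * (√((K + 1 : ℕ) : ℝ) - √(K : ℝ)) := by
      rw [div_le_iff₀ h1]
      nlinarith [sq_nonneg (√((K + 1 : ℕ) : ℝ) - √(K : ℝ))]
    linarith

lemma sum_one_div_le (K : ℕ) : ∑ k ∈ Finset.Icc 1 K, 1 / (k : ℝ) ≤ 1 + Real.log K := by
  have := harmonic_le_one_add_log K
  rw [harmonic_eq_sum_Icc] at this
  simpa using this

/-- On a residue class the quotient `N / w` determines `N`. Positive quotients `k` contribute at
most `1/√(wk)`. For quotient zero, `w ≤ 2N` gives `1/√N = √N / N ≤ 2√X / w`; without that condition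
the saving of `1/w` would fail. -/
lemma sum_one_div_sqrt_residue_le {w : ℕ} (hw : 0 < w) (c : ZMod w) (X : ℕ) :
    ∑ N ∈ (Finset.Icc 1 X).filter (fun N : ℕ => (N : ZMod w) = c ∧ w ≤ 2 * N), 1 / √(N : ℝ)
      ≤ 4 * √(X : ℝ) / w := by
  set S := (Finset.Icc 1 X).filter (fun N : ℕ => (N : ZMod w) = c ∧ w ≤ 2 * N) with hS
  have hw' : (0 : ℝ) < w := by exact_mod_cast hw
  set g : ℕ → ℝ := fun k => if k = 0 then 2 * √(X : ℝ) / w else 1 / √(w : ℝ) * (1 / √(k : ℝ))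
    with hg
  have hg0 : ∀ k, 0 ≤ g k := fun k => by
    simp only [hg]; split_ifs <;> positivity
  have h1 : ∀ N ∈ S, 1 / √(N : ℝ) ≤ g (N / w) := by
    intro N hN
    simp only [hS, Finset.mem_filter, Finset.mem_Icc] at hN
    obtain ⟨⟨hN1, hNX⟩, -, hwN⟩ := hN
    have hN0 : (0 : ℝ) < N := by exact_mod_cast hN1
    have hwN' : (w : ℝ) ≤ 2 * N := by exact_mod_cast hwN
    have hNX' : (N : ℝ) ≤ X := by exact_mod_cast hNX
    simp only [hg]
    split_ifs with hk
    · have hsq : √(N : ℝ) * √(N : ℝ) = N := Real.mul_self_sqrt hN0.le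
      have hs0 : 0 < √(N : ℝ) := Real.sqrt_pos.2 hN0
      rw [div_le_div_iff₀ hs0 hw']
      have : √(N : ℝ) ≤ √(X : ℝ) := Real.sqrt_le_sqrt hNX'
      nlinarith
    · rw [one_div_mul_one_div, ← Real.sqrt_mul hw'.le]
      have hpos : 0 < w * (N / w) := Nat.mul_pos hw (Nat.pos_of_ne_zero hk)
      have := one_div_sqrt_anti hpos (Nat.mul_div_le N w)
      rwa [Nat.cast_mul] at this
  have hinj : Set.InjOn (fun N : ℕ => N / w) (S : Set ℕ) := by
    intro a ha b hb hab
    simp only [hS, Finset.coe_filter, Set.mem_ofPred_eq] at ha hb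
    have hmod : a % w = b % w := by
      have : (a : ZMod w) = b := ha.2.1.trans hb.2.1.symm
      rwa [ZMod.natCast_eq_natCast_iff] at this
    rw [← Nat.div_add_mod a w, ← Nat.div_add_mod b w, hmod]
    simp only at hab
    rw [hab]
  calc _ ≤ ∑ N ∈ S, g (N / w) := Finset.sum_le_sum h1
    _ = ∑ k ∈ S.image (fun N => N / w), g k := (Finset.sum_image hinj).symm
    _ ≤ ∑ k ∈ Finset.range (X / w + 1), g k := by
        refine Finset.sum_le_sum_of_subset_of_nonneg ?_ (fun k _ _ => hg0 k)
        intro k hk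
        obtain ⟨N, hN, rfl⟩ := Finset.mem_image.1 hk
        simp only [hS, Finset.mem_filter, Finset.mem_Icc] at hN
        exact Finset.mem_range.2 (Nat.lt_succ_of_le (Nat.div_le_div_right hN.1.2))
    _ = 1 / √(w : ℝ) * ∑ k ∈ Finset.Icc 1 (X / w), 1 / √(k : ℝ) + 2 * √(X : ℝ) / w := by
        rw [Finset.sum_range_succ', Finset.mul_sum]
        congr 1
        rw [Finset.range_eq_Ico, Finset.sum_Ico_add' g 0 (X / w) 1]
        refine Finset.sum_congr (by ext; simp) fun k hk => ?_
        rw [Finset.mem_Icc] at hk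
        simp only [hg]
        rw [if_neg (by omega)]
    _ ≤ 1 / √(w : ℝ) * (2 * √((X : ℝ) / w)) + 2 * √(X : ℝ) / w := by
        gcongr
        refine (sum_one_div_sqrt_le _).trans ?_
        gcongr
        exact Nat.cast_div_le
    _ = _ := by
        rw [Real.sqrt_div (Nat.cast_nonneg X)]
        have : √(w : ℝ) * √(w : ℝ) = w := Real.mul_self_sqrt hw'.le
        have hs0 : 0 < √(w : ℝ) := Real.sqrt_pos.2 hw'
        field_simp
        rw [pow_two, this]
        ring

/-! ### Hyperbolic sums and off-diagonal congruences -/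

/-- Pairs of positive integers with product at most `Y`. -/
def pairs (Y : ℕ) : Finset (ℕ × ℕ) :=
  (Finset.Icc 1 Y ×ˢ Finset.Icc 1 Y).filter fun p => p.1 * p.2 ≤ Y

lemma mem_pairs {Y : ℕ} {p : ℕ × ℕ} : p ∈ pairs Y ↔ 1 ≤ p.1 ∧ 1 ≤ p.2 ∧ p.1 * p.2 ≤ Y := by
  simp only [pairs, Finset.mem_filter, Finset.mem_product, Finset.mem_Icc]
  constructor
  · rintro ⟨⟨⟨h1, _⟩, h2, _⟩, h⟩
    exact ⟨h1, h2, h⟩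
  · rintro ⟨h1, h2, h⟩
    exact ⟨⟨⟨h1, by nlinarith⟩, h2, by nlinarith⟩, h⟩

lemma sum_pairs {M : Type*} [AddCommMonoid M] (Y : ℕ) (f : ℕ → ℕ → M) :
    ∑ p ∈ pairs Y, f p.1 p.2 = ∑ m ∈ Finset.Icc 1 Y, ∑ n ∈ Finset.Icc 1 (Y / m), f m n := by
  rw [Finset.sum_sigma']
  refine Finset.sum_bij' (fun p _ => ⟨p.1, p.2⟩) (fun x _ => (x.1, x.2)) ?_ ?_ ?_ ?_ ?_
  · rintro ⟨m, n⟩ h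
    obtain ⟨h1, h2, h3⟩ := mem_pairs.1 h
    simp only at h1 h2 h3
    simp only [Finset.mem_sigma, Finset.mem_Icc]
    exact ⟨⟨h1, by nlinarith⟩, h2, (Nat.le_div_iff_mul_le h1).2 (by linarith)⟩
  · rintro ⟨m, n⟩ h
    simp only [Finset.mem_sigma, Finset.mem_Icc] at h
    exact mem_pairs.2 ⟨h.1.1, h.2.1, by
      have := (Nat.le_div_iff_mul_le h.1.1).1 h.2.2
      simp only; linarith⟩
  all_goals simp

lemma sum_pairs_swap {M : Type*} [AddCommMonoid M] (Y : ℕ) (f : ℕ → ℕ → M) :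
    ∑ p ∈ pairs Y, f p.1 p.2 = ∑ p ∈ pairs Y, f p.2 p.1 := by
  refine Finset.sum_bij' (fun p _ => p.swap) (fun p _ => p.swap) ?_ ?_ ?_ ?_ ?_
  · intro p hp
    obtain ⟨h1, h2, h3⟩ := mem_pairs.1 hp
    exact mem_pairs.2 ⟨h2, h1, by rw [mul_comm] at h3; exact h3⟩
  · intro p hp
    obtain ⟨h1, h2, h3⟩ := mem_pairs.1 hp
    exact mem_pairs.2 ⟨h2, h1, by rw [mul_comm] at h3; exact h3⟩
  all_goals simp

lemma sqrt_natDiv_le (Y m : ℕ) : √((Y / m : ℕ) : ℝ) ≤ √(Y : ℝ) / √(m : ℝ) := by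
  rw [← Real.sqrt_div (Nat.cast_nonneg Y)]
  exact Real.sqrt_le_sqrt Nat.cast_div_le

lemma sum_sqrt_aux (Y : ℕ) (K : ℝ) (hK : 0 ≤ K) :
    ∑ m ∈ Finset.Icc 1 Y, 1 / √(m : ℝ) * (K * (√(Y : ℝ) / √(m : ℝ)))
      ≤ K * √(Y : ℝ) * (1 + Real.log Y) := by
  have : ∀ m ∈ Finset.Icc 1 Y, 1 / √(m : ℝ) * (K * (√(Y : ℝ) / √(m : ℝ)))
      = K * √(Y : ℝ) * (1 / (m : ℝ)) := by
    intro m hm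
    have hm' : 1 / (m : ℝ) = 1 / √(m : ℝ) * (1 / √(m : ℝ)) := by
      rw [one_div_mul_one_div, Real.mul_self_sqrt (Nat.cast_nonneg m)]
    rw [hm']
    ring
  rw [Finset.sum_congr rfl this, ← Finset.mul_sum]
  gcongr
  exact sum_one_div_le Y

lemma sum_pairs_one_div_sqrt_le (Y : ℕ) :
    ∑ p ∈ pairs Y, 1 / √(p.1 : ℝ) * (1 / √(p.2 : ℝ)) ≤ 2 * √(Y : ℝ) * (1 + Real.log Y) := by
  rw [sum_pairs Y fun m n => 1 / √(m : ℝ) * (1 / √(n : ℝ))]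
  refine le_trans (Finset.sum_le_sum fun m _ => ?_) (sum_sqrt_aux Y 2 (by norm_num))
  rw [← Finset.mul_sum]
  gcongr
  exact (sum_one_div_sqrt_le _).trans (by gcongr; exact sqrt_natDiv_le Y m)

/-- The number of signs for which `N ≡ ±m` modulo `w`, the equality `N = m` being left out. -/
def offDiag (w m N : ℕ) : ℝ :=
  (if (N : ZMod w) = m ∧ N ≠ m then 1 else 0) + if (N : ZMod w) = -m then 1 else 0

lemma offDiag_nonneg (w m N : ℕ) : 0 ≤ offDiag w m N := by
  unfold offDiag; split_ifs <;> norm_num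

/-- The number of signs for which `N ≡ ±m` modulo `w`, provided that `w ≤ 2 N`. -/
def farDiag (w m N : ℕ) : ℝ :=
  (if (N : ZMod w) = m ∧ w ≤ 2 * N then 1 else 0) + if (N : ZMod w) = -m ∧ w ≤ 2 * N then 1 else 0

/-- The modulus divides the nonzero integer `m - N` or the positive integer `m + N`, so it is at
most twice the larger of the two. -/
lemma le_two_mul_of_congr {w m N : ℕ} (hm : 1 ≤ m)
    (h : ((N : ZMod w) = m ∧ N ≠ m) ∨ (N : ZMod w) = -m) : w ≤ 2 * N ∨ w ≤ 2 * m := by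
  rcases h with ⟨h, hne⟩ | h
  · have h' : (w : ℤ) ∣ (m : ℤ) - N := by
      rw [← ZMod.intCast_eq_intCast_iff_dvd_sub]
      exact_mod_cast h
    have h0 : ((m : ℤ) - N) ≠ 0 := by omega
    have := Int.le_of_dvd (abs_pos.2 h0) ((dvd_abs _ _).2 h')
    rcases abs_cases ((m : ℤ) - N) with hh | hh <;> omega
  · have h' : w ∣ N + m := by
      rw [← ZMod.natCast_eq_zero_iff]
      push_cast
      rw [h]; ring
    have := Nat.le_of_dvd (by omega) h'
    omega

lemma offDiag_le (w m N : ℕ) (hm : 1 ≤ m) :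
    offDiag w m N ≤ farDiag w m N + farDiag w N m := by
  have e1 : (m : ZMod w) = N ↔ (N : ZMod w) = m := eq_comm
  have e2 : (m : ZMod w) = -N ↔ (N : ZMod w) = -m := by
    rw [← neg_eq_iff_eq_neg, eq_comm]
  have h := @le_two_mul_of_congr w m N hm
  unfold offDiag farDiag
  simp only [e1, e2]
  have hb : ∀ (p : Prop) [Decidable p], (0 : ℝ) ≤ if p then 1 else 0 := fun p _ => by
    split_ifs <;> norm_num
  have k1 : (if (N : ZMod w) = m ∧ N ≠ m then (1 : ℝ) else 0) ≤
      (if (N : ZMod w) = m ∧ w ≤ 2 * N then 1 else 0)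
        + if (N : ZMod w) = m ∧ w ≤ 2 * m then 1 else 0 := by
    by_cases hc : (N : ZMod w) = m ∧ N ≠ m
    · rw [if_pos hc]
      rcases h (Or.inl hc) with h' | h'
      · rw [if_pos ⟨hc.1, h'⟩]; linarith [hb ((N : ZMod w) = m ∧ w ≤ 2 * m)]
      · rw [if_pos (c := (N : ZMod w) = m ∧ w ≤ 2 * m) ⟨hc.1, h'⟩]
        linarith [hb ((N : ZMod w) = m ∧ w ≤ 2 * N)]
    · rw [if_neg hc]; exact add_nonneg (hb _) (hb _)
  have k2 : (if (N : ZMod w) = -m then (1 : ℝ) else 0) ≤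
      (if (N : ZMod w) = -m ∧ w ≤ 2 * N then 1 else 0)
        + if (N : ZMod w) = -m ∧ w ≤ 2 * m then 1 else 0 := by
    by_cases hc : (N : ZMod w) = -m
    · rw [if_pos hc]
      rcases h (Or.inr hc) with h' | h'
      · rw [if_pos ⟨hc, h'⟩]; linarith [hb ((N : ZMod w) = -m ∧ w ≤ 2 * m)]
      · rw [if_pos (c := (N : ZMod w) = -m ∧ w ≤ 2 * m) ⟨hc, h'⟩]
        linarith [hb ((N : ZMod w) = -m ∧ w ≤ 2 * N)]
    · rw [if_neg hc]; exact add_nonneg (hb _) (hb _)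
  linarith

/-- For each `m` and each sign the inner sum over `N ≤ Z / m` is at most `4 √(Z/m) / w`; the
remaining sum of `1/m` gives the logarithm. -/
lemma sum_pairs_farDiag_le {w : ℕ} (hw : 0 < w) (Z : ℕ) :
    ∑ p ∈ pairs Z, farDiag w p.1 p.2 * (1 / √(p.1 : ℝ) * (1 / √(p.2 : ℝ)))
      ≤ 8 / w * √(Z : ℝ) * (1 + Real.log Z) := by
  rw [sum_pairs Z fun m n => farDiag w m n * (1 / √(m : ℝ) * (1 / √(n : ℝ)))]
  refine le_trans (Finset.sum_le_sum fun m _ => ?_) (sum_sqrt_aux Z (8 / w) (by positivity))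
  have h (c : ZMod w) := sum_one_div_sqrt_residue_le hw c (Z / m)
  calc _ = 1 / √(m : ℝ) *
        (∑ N ∈ (Finset.Icc 1 (Z / m)).filter (fun N : ℕ => (N : ZMod w) = m ∧ w ≤ 2 * N),
            1 / √(N : ℝ)
          + ∑ N ∈ (Finset.Icc 1 (Z / m)).filter (fun N : ℕ => (N : ZMod w) = -m ∧ w ≤ 2 * N),
            1 / √(N : ℝ)) := by
        rw [Finset.sum_filter, Finset.sum_filter, ← Finset.sum_add_distrib, Finset.mul_sum]
        refine Finset.sum_congr rfl fun N _ => ?_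
        unfold farDiag
        split_ifs <;> ring
    _ ≤ 1 / √(m : ℝ) * (4 * √((Z / m : ℕ) : ℝ) / w + 4 * √((Z / m : ℕ) : ℝ) / w) := by
        gcongr
        · exact h m
        · exact h (-m)
    _ = 1 / √(m : ℝ) * (8 / w * √((Z / m : ℕ) : ℝ)) := by ring
    _ ≤ _ := by gcongr; exact sqrt_natDiv_le Z m

/-- One of the two variables is at least `w/2`. The domain and weight are symmetric, so both cases
reduce to the preceding bound, which doubles the constant. -/
lemma sum_pairs_offDiag_le {w : ℕ} (hw : 0 < w) (Z : ℕ) :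
    ∑ p ∈ pairs Z, offDiag w p.1 p.2 * (1 / √(p.1 : ℝ) * (1 / √(p.2 : ℝ)))
      ≤ 16 / w * √(Z : ℝ) * (1 + Real.log Z) := by
  calc _ ≤ ∑ p ∈ pairs Z, (farDiag w p.1 p.2 * (1 / √(p.1 : ℝ) * (1 / √(p.2 : ℝ)))
        + farDiag w p.2 p.1 * (1 / √(p.2 : ℝ) * (1 / √(p.1 : ℝ)))) := by
        refine Finset.sum_le_sum fun p hp => ?_
        rw [mul_comm (1 / √(p.2 : ℝ)), ← add_mul]
        gcongr
        exact offDiag_le _ _ _ (mem_pairs.1 hp).1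
    _ = 2 * ∑ p ∈ pairs Z, farDiag w p.1 p.2 * (1 / √(p.1 : ℝ) * (1 / √(p.2 : ℝ))) := by
        rw [Finset.sum_add_distrib,
          ← sum_pairs_swap Z fun m n => farDiag w m n * (1 / √(m : ℝ) * (1 / √(n : ℝ)))]
        ring
    _ ≤ 2 * (8 / w * √(Z : ℝ) * (1 + Real.log Z)) := by
        gcongr
        exact sum_pairs_farDiag_le hw Z
    _ = _ := by ring

/-- When `N = m` is coprime to `q`, the congruence with sign `+` holds for every `w ∣ q` and its
weights add up to `φ⁺(q)`. The other congruences carry weights `μ φ(w)/2`, bounded by `w`. If `m` or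
`N` shares a factor with `q`, both terms of the difference vanish. -/
lemma norm_sum_evenPrimitive_sub_le (q : ℕ) [NeZero q] (m N : ℕ) :
    ‖∑ χ ∈ evenPrimitive q, conj (χ m) * χ N
        - (phiPlus q : ℂ) * (if N = m ∧ m.Coprime q then 1 else 0)‖
      ≤ ∑ w ∈ q.divisors, (w : ℝ) * offDiag w m N := by
  have hnn : 0 ≤ ∑ w ∈ q.divisors, (w : ℝ) * offDiag w m N :=
    Finset.sum_nonneg fun w _ => mul_nonneg (Nat.cast_nonneg _) (offDiag_nonneg _ _ _)
  have hzero (n : ℕ) (hn : ¬ n.Coprime q) (χ : DirichletCharacter ℂ q) : χ n = 0 :=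
    χ.map_nonunit fun h => hn ((ZMod.isUnit_iff_coprime n q).1 h)
  by_cases hm : m.Coprime q
  swap
  · have hne : ¬ (N = m ∧ m.Coprime q) := fun h => hm h.2
    rw [Finset.sum_eq_zero fun χ _ => by rw [hzero m hm, map_zero, zero_mul], if_neg hne]
    simpa using hnn
  by_cases hN : N.Coprime q
  swap
  · have hne : ¬ (N = m ∧ m.Coprime q) := fun h => hN (h.1 ▸ h.2)
    rw [Finset.sum_eq_zero fun χ _ => by rw [hzero N hN, mul_zero], if_neg hne]
    simpa using hnn
  have hphi : (phiPlus q : ℂ) = ∑ x ∈ q.divisorsAntidiagonal,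
      (ArithmeticFunction.moebius x.1 : ℂ) * (x.2.totient : ℂ) / 2 := by
    rw [phiPlus, Complex.ofReal_div, phiStar_eq, Finset.sum_div]
    simp
  rw [sum_evenPrimitive hm hN, hphi, Finset.sum_mul, ← Finset.sum_sub_distrib,
    ← Nat.sum_divisorsAntidiagonal' (f := fun _ w => (w : ℝ) * offDiag w m N)]
  refine (norm_sum_le _ _).trans (Finset.sum_le_sum fun x _ => ?_)
  have hoff : ((if (N : ZMod x.2) = m then (1 : ℂ) else 0) + if (N : ZMod x.2) = -m then 1 else 0)
      - (if N = m ∧ m.Coprime q then 1 else 0) = (offDiag x.2 m N : ℂ) := by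
    by_cases h : N = m
    · rw [if_pos (⟨h, hm⟩ : N = m ∧ m.Coprime q)]
      simp only [offDiag, h, ne_eq, not_true_eq_false, and_false, if_false, if_true]
      split_ifs <;> simp
    · rw [if_neg fun hh : N = m ∧ m.Coprime q => h hh.1]
      simp only [offDiag, h, ne_eq, not_false_eq_true, and_true]
      split_ifs <;> simp
  rw [← mul_sub, hoff, norm_mul, Complex.norm_real, Real.norm_eq_abs,
    abs_of_nonneg (offDiag_nonneg _ _ _)]
  gcongr
  · exact offDiag_nonneg _ _ _
  have h1 : ‖(ArithmeticFunction.moebius x.1 : ℂ)‖ ≤ 1 := by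
    rw [Complex.norm_intCast]
    exact_mod_cast ArithmeticFunction.abs_moebius_le_one
  have h2 : (x.2.totient : ℝ) ≤ x.2 := by exact_mod_cast Nat.totient_le x.2
  rw [norm_div, norm_mul, Complex.norm_natCast, Complex.norm_ofNat]
  have h3 : ‖(ArithmeticFunction.moebius x.1 : ℂ)‖ * (x.2.totient : ℝ) ≤ 1 * x.2 := by gcongr
  have : (0 : ℝ) ≤ x.2 := Nat.cast_nonneg _
  linarith

/-- Grouping by `N = l n` leaves `m` fixed, and `l ∣ N` then determines the triple, so each fibre
has at most `d(N)` elements. -/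
lemma sum_pairs_mul_le (Y q : ℕ) {G : ℕ → ℕ → ℝ} (hG : ∀ m N, 0 ≤ G m N) :
    ∑ p ∈ pairs Y, ∑ l ∈ Finset.Icc 1 q, G p.1 (l * p.2)
      ≤ ∑ r ∈ pairs (q * Y), (r.2.divisors.card : ℝ) * G r.1 r.2 := by
  rw [← Finset.sum_product']
  have hmaps : ∀ x ∈ pairs Y ×ˢ Finset.Icc 1 q, (x.1.1, x.2 * x.1.2) ∈ pairs (q * Y) := by
    rintro ⟨⟨m, n⟩, l⟩ hx
    obtain ⟨hp, hl⟩ := Finset.mem_product.1 hx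
    obtain ⟨h1, h2, h3⟩ := mem_pairs.1 hp
    simp only [Finset.mem_Icc] at h1 h2 h3 hl
    refine mem_pairs.2 ⟨h1, Nat.mul_pos hl.1 h2, ?_⟩
    calc m * (l * n) = l * (m * n) := by ring
      _ ≤ q * Y := Nat.mul_le_mul hl.2 h3
  rw [← Finset.sum_fiberwise_of_maps_to hmaps]
  refine Finset.sum_le_sum fun r hr => ?_
  obtain ⟨hr1, hr2, -⟩ := mem_pairs.1 hr
  set F := (pairs Y ×ˢ Finset.Icc 1 q).filter fun x => (x.1.1, x.2 * x.1.2) = r with hF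
  have hmem {x : (ℕ × ℕ) × ℕ} (hx : x ∈ F) :
      1 ≤ x.2 ∧ x.1.1 = r.1 ∧ x.2 * x.1.2 = r.2 := by
    obtain ⟨h1, h2⟩ := Finset.mem_filter.1 hx
    exact ⟨(Finset.mem_Icc.1 (Finset.mem_product.1 h1).2).1, (Prod.ext_iff.1 h2).1,
      (Prod.ext_iff.1 h2).2⟩
  have hcard : F.card ≤ r.2.divisors.card := by
    refine Finset.card_le_card_of_injOn (fun x => x.2) ?_ ?_
    · intro x hx
      obtain ⟨-, -, h⟩ := hmem hx
      exact Nat.mem_divisors.2 ⟨⟨x.1.2, h.symm⟩, by omega⟩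
    · rintro ⟨⟨a, b⟩, l⟩ hx ⟨⟨a', b'⟩, l'⟩ hy hxy
      obtain ⟨h0, h1, h2⟩ := hmem hx
      obtain ⟨-, h1', h2'⟩ := hmem hy
      simp only at h0 h1 h2 h1' h2' hxy
      subst hxy
      have : b = b' := Nat.eq_of_mul_eq_mul_left h0 (h2.trans h2'.symm)
      rw [h1, h1', this]
  calc _ = ∑ x ∈ F, G r.1 r.2 := Finset.sum_congr rfl fun x hx => by
        obtain ⟨-, h1, h2⟩ := hmem hx
        rw [h1, h2]
    _ = (F.card : ℝ) * G r.1 r.2 := by rw [Finset.sum_const, nsmul_eq_mul]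
    _ ≤ _ := by
        gcongr
        exact hG _ _

/-! ### Reduction of the moment to its diagonal -/

/-- A mollifier with coefficients `c` twisted by `χ̄(m) χ(n)`. -/
noncomputable def twisted {q : ℕ} (c : ℕ × ℕ → ℂ) (Y : ℕ) (χ : DirichletCharacter ℂ q) : ℂ :=
  ∑ p ∈ pairs Y, c p * conj (χ p.1) * χ p.2 / (√((p.1 * p.2 : ℕ) : ℝ) : ℂ)

lemma ne_one_of_mem_evenPrimitive {q : ℕ} [NeZero q] (hq : 2 ≤ q) {χ : DirichletCharacter ℂ q}
    (hχ : χ ∈ evenPrimitive q) : χ ≠ 1 := by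
  rintro rfl
  simp only [evenPrimitive, Finset.mem_filter, DirichletCharacter.isPrimitive_def,
    DirichletCharacter.conductor_one] at hχ
  omega

lemma norm_S₁_twisted_sub_le {q : ℕ} [NeZero q] (hq : 2 ≤ q) {h : ℕ → ℝ}
    (hh : ∀ l ∈ Finset.Icc 1 q, |h l| ≤ 1 / √(q : ℝ))
    (hL : ∀ χ : DirichletCharacter ℂ q, χ ≠ 1 → DirichletCharacter.LFunction χ (1 / 2)
        = ∑ l ∈ Finset.Icc 1 q, χ l * ((1 / √(l : ℝ) + h l : ℝ) : ℂ))
    {c : ℕ × ℕ → ℂ} {Y : ℕ} {B : ℝ} (hc : ∀ p ∈ pairs Y, ‖c p‖ ≤ B) (hB : 0 ≤ B) :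
    ‖S₁ q (twisted c Y) - ∑ p ∈ pairs Y, ∑ l ∈ Finset.Icc 1 q,
        ((1 / √(l : ℝ) + h l : ℝ) : ℂ) * (c p / (√((p.1 * p.2 : ℕ) : ℝ) : ℂ)) *
          ((phiPlus q : ℂ) * (if l * p.2 = p.1 ∧ p.1.Coprime q then 1 else 0))‖
      ≤ 2 * B * ∑ w ∈ q.divisors, (w : ℝ) * ∑ r ∈ pairs (q * Y), (r.2.divisors.card : ℝ) *
          (offDiag w r.1 r.2 * (1 / √(r.1 : ℝ) * (1 / √(r.2 : ℝ)))) := by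
  have hS : S₁ q (twisted c Y) = ∑ p ∈ pairs Y, ∑ l ∈ Finset.Icc 1 q,
      ((1 / √(l : ℝ) + h l : ℝ) : ℂ) * (c p / (√((p.1 * p.2 : ℕ) : ℝ) : ℂ)) *
        ∑ χ ∈ evenPrimitive q, conj (χ p.1) * χ ((l * p.2 : ℕ) : ZMod q) := by
    calc S₁ q (twisted c Y) = ∑ χ ∈ evenPrimitive q, ∑ p ∈ pairs Y, ∑ l ∈ Finset.Icc 1 q,
          ((1 / √(l : ℝ) + h l : ℝ) : ℂ) * (c p / (√((p.1 * p.2 : ℕ) : ℝ) : ℂ)) *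
          (conj (χ p.1) * χ ((l * p.2 : ℕ) : ZMod q)) := by
          refine Finset.sum_congr rfl fun χ hχ => ?_
          rw [hL χ (ne_one_of_mem_evenPrimitive hq hχ), twisted, Finset.sum_mul_sum,
            Finset.sum_comm]
          refine Finset.sum_congr rfl fun p _ => Finset.sum_congr rfl fun l _ => ?_
          rw [Nat.cast_mul l, map_mul]
          ring
      _ = _ := by
          rw [Finset.sum_comm]
          refine Finset.sum_congr rfl fun p _ => ?_
          rw [Finset.sum_comm]
          refine Finset.sum_congr rfl fun l _ => ?_
          rw [Finset.mul_sum]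
  have hterm : ∀ p ∈ pairs Y, ∀ l ∈ Finset.Icc 1 q,
      ‖((1 / √(l : ℝ) + h l : ℝ) : ℂ) * (c p / (√((p.1 * p.2 : ℕ) : ℝ) : ℂ)) *
        (∑ χ ∈ evenPrimitive q, conj (χ p.1) * χ ((l * p.2 : ℕ) : ZMod q)
        - (phiPlus q : ℂ) * (if l * p.2 = p.1 ∧ p.1.Coprime q then 1 else 0))‖
      ≤ 2 * B * ∑ w ∈ q.divisors, (w : ℝ) * (offDiag w p.1 (l * p.2) *
        (1 / √(p.1 : ℝ) * (1 / √((l * p.2 : ℕ) : ℝ)))) := by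
    intro p hp l hl
    have hl' := Finset.mem_Icc.1 hl
    rw [norm_mul, norm_mul, norm_div, Complex.norm_real, Complex.norm_real, Real.norm_eq_abs,
      Real.norm_eq_abs, abs_of_nonneg (Real.sqrt_nonneg _)]
    -- As `l ≤ q`, the correction `h l` never exceeds `1/√l`; this is the source of the factor `2`.
    have h1 : |1 / √(l : ℝ) + h l| ≤ 2 * (1 / √(l : ℝ)) := by
      have h2 := one_div_sqrt_anti hl'.1 hl'.2
      have h3 : 0 ≤ 1 / √(l : ℝ) := by positivity
      calc _ ≤ |1 / √(l : ℝ)| + |h l| := abs_add_le _ _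
        _ ≤ 1 / √(l : ℝ) + 1 / √(q : ℝ) := by rw [abs_of_nonneg h3]; gcongr; exact hh l hl
        _ ≤ _ := by linarith
    calc _ ≤ 2 * (1 / √(l : ℝ)) * (B / √((p.1 * p.2 : ℕ) : ℝ)) *
          ∑ w ∈ q.divisors, (w : ℝ) * offDiag w p.1 (l * p.2) := by
          gcongr
          · exact hc p hp
          · exact norm_sum_evenPrimitive_sub_le q p.1 (l * p.2)
      _ = _ := by
          rw [Finset.mul_sum, Finset.mul_sum]
          refine Finset.sum_congr rfl fun w _ => ?_
          rw [Nat.cast_mul, Nat.cast_mul, Real.sqrt_mul (Nat.cast_nonneg _),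
            Real.sqrt_mul (Nat.cast_nonneg _)]
          ring
  rw [hS, ← Finset.sum_sub_distrib]
  simp_rw [← Finset.sum_sub_distrib, ← mul_sub]
  calc _ ≤ ∑ p ∈ pairs Y, ∑ l ∈ Finset.Icc 1 q, 2 * B * ∑ w ∈ q.divisors, (w : ℝ) *
        (offDiag w p.1 (l * p.2) * (1 / √(p.1 : ℝ) * (1 / √((l * p.2 : ℕ) : ℝ)))) :=
        (norm_sum_le _ _).trans (Finset.sum_le_sum fun p hp =>
          (norm_sum_le _ _).trans (Finset.sum_le_sum fun l hl => hterm p hp l hl))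
    _ = 2 * B * ∑ w ∈ q.divisors, (w : ℝ) * ∑ p ∈ pairs Y, ∑ l ∈ Finset.Icc 1 q,
        (offDiag w p.1 (l * p.2) * (1 / √(p.1 : ℝ) * (1 / √((l * p.2 : ℕ) : ℝ)))) := by
        simp_rw [Finset.mul_sum]
        symm
        rw [Finset.sum_comm]
        refine Finset.sum_congr rfl fun p _ => ?_
        rw [Finset.sum_comm]
    _ ≤ _ := by
        gcongr with w hw
        exact sum_pairs_mul_le Y q
          (G := fun m N => offDiag w m N * (1 / √(m : ℝ) * (1 / √(N : ℝ))))
          fun m N => mul_nonneg (offDiag_nonneg _ _ _) (by positivity)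

/-- The equation `l n = m` determines `l = m / n`, and then `1/√l · 1/√(mn) = 1/m` is the main term.
Only `h` is left as error, of size `q^{-1/2}` against `|φ⁺(q)| ≤ q/2`. -/
lemma norm_diagonal_sub_le {q : ℕ} [NeZero q] {h : ℕ → ℝ}
    (hh : ∀ l ∈ Finset.Icc 1 q, |h l| ≤ 1 / √(q : ℝ))
    {c : ℕ × ℕ → ℂ} {Y : ℕ} (hY : Y ≤ q) {B : ℝ} (hc : ∀ p ∈ pairs Y, ‖c p‖ ≤ B) (hB : 0 ≤ B) :
    ‖∑ p ∈ pairs Y, ∑ l ∈ Finset.Icc 1 q,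
        ((1 / √(l : ℝ) + h l : ℝ) : ℂ) * (c p / (√((p.1 * p.2 : ℕ) : ℝ) : ℂ)) *
          ((phiPlus q : ℂ) * (if l * p.2 = p.1 ∧ p.1.Coprime q then 1 else 0))
      - (phiPlus q : ℂ) * ∑ p ∈ (pairs Y).filter (fun p => p.2 ∣ p.1 ∧ p.1.Coprime q),
          c p / (p.1 : ℂ)‖
      ≤ B * √((q * Y : ℕ) : ℝ) * (1 + Real.log Y) := by
  have hq : (0 : ℝ) < q := by exact_mod_cast Nat.pos_of_ne_zero (NeZero.ne q)
  rw [Finset.sum_filter, Finset.mul_sum, ← Finset.sum_sub_distrib]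
  have hphi : |phiPlus q| ≤ q / 2 := by
    rw [phiPlus, abs_div, abs_two]
    gcongr
    exact abs_phiStar_le q
  have hterm : ∀ p ∈ pairs Y, ‖∑ l ∈ Finset.Icc 1 q,
        ((1 / √(l : ℝ) + h l : ℝ) : ℂ) * (c p / (√((p.1 * p.2 : ℕ) : ℝ) : ℂ)) *
          ((phiPlus q : ℂ) * (if l * p.2 = p.1 ∧ p.1.Coprime q then 1 else 0))
      - (phiPlus q : ℂ) * (if p.2 ∣ p.1 ∧ p.1.Coprime q then c p / (p.1 : ℂ) else 0)‖
      ≤ q / 2 * B * (1 / √(q : ℝ)) * (1 / √(p.1 : ℝ) * (1 / √(p.2 : ℝ))) := by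
    intro p hp
    obtain ⟨h1, h2, h3⟩ := mem_pairs.1 hp
    have hnn : 0 ≤ q / 2 * B * (1 / √(q : ℝ)) * (1 / √(p.1 : ℝ) * (1 / √(p.2 : ℝ))) := by
      positivity
    by_cases hd : p.2 ∣ p.1 ∧ p.1.Coprime q
    · obtain ⟨⟨k, hk⟩, hcop⟩ := hd
      have hk1 : 1 ≤ k := Nat.pos_of_ne_zero (by rintro rfl; omega)
      -- This is where `Y ≤ q` is needed: the cofactor `m / n` must lie in the range of the finite
      -- sum for the central value.
      have hkq : k ∈ Finset.Icc 1 q := Finset.mem_Icc.2 ⟨hk1, by nlinarith⟩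
      rw [Finset.sum_eq_single k, if_pos ⟨by rw [hk, mul_comm], hcop⟩,
        if_pos ⟨⟨k, hk⟩, hcop⟩]
      · have hs : (√((p.1 * p.2 : ℕ) : ℝ)) * √(k : ℝ) = p.1 := by
          rw [← Real.sqrt_mul (Nat.cast_nonneg _), ← Nat.cast_mul, mul_assoc, ← hk, Nat.cast_mul,
            Real.sqrt_mul_self (Nat.cast_nonneg _)]
        have hs' : (p.1 : ℂ) = (√((p.1 * p.2 : ℕ) : ℝ) : ℂ) * (√(k : ℝ) : ℂ) := by
          rw [← Complex.ofReal_mul, hs]; simp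
        have heq : ((1 / √(k : ℝ) + h k : ℝ) : ℂ) * (c p / (√((p.1 * p.2 : ℕ) : ℝ) : ℂ)) *
            ((phiPlus q : ℂ) * 1) - (phiPlus q : ℂ) * (c p / (p.1 : ℂ))
            = (phiPlus q : ℂ) * c p * (h k : ℂ) * ((1 / √((p.1 * p.2 : ℕ) : ℝ) : ℝ) : ℂ) := by
          rw [hs']
          push_cast
          ring
        rw [heq, norm_mul, norm_mul, norm_mul, Complex.norm_real, Complex.norm_real,
          Complex.norm_real, Real.norm_eq_abs, Real.norm_eq_abs, Real.norm_eq_abs,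
          abs_of_nonneg (a := 1 / √((p.1 * p.2 : ℕ) : ℝ)) (by positivity), one_div_mul_one_div,
          ← Real.sqrt_mul (Nat.cast_nonneg _), ← Nat.cast_mul]
        gcongr
        · exact hc p hp
        · exact hh k hkq
      · intro l _ hl
        rw [if_neg, mul_zero, mul_zero]
        rintro ⟨hl', -⟩
        apply hl
        apply Nat.eq_of_mul_eq_mul_right h2
        rw [hl', hk, mul_comm]
      · intro hk'; exact absurd hkq hk'
    · rw [if_neg hd, Finset.sum_eq_zero, mul_zero, sub_zero, norm_zero]
      · exact hnn
      · intro l _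
        rw [if_neg, mul_zero, mul_zero]
        rintro ⟨hl', hcop⟩
        exact hd ⟨⟨l, by rw [← hl', mul_comm]⟩, hcop⟩
  refine (norm_sum_le _ _).trans ((Finset.sum_le_sum hterm).trans ?_)
  rw [← Finset.mul_sum]
  calc _ ≤ q / 2 * B * (1 / √(q : ℝ)) * (2 * √(Y : ℝ) * (1 + Real.log Y)) := by
        gcongr
        exact sum_pairs_one_div_sqrt_le Y
    _ = _ := by
        rw [Nat.cast_mul, Real.sqrt_mul hq.le]
        have hs : √(q : ℝ) ≠ 0 := (Real.sqrt_pos.2 hq).ne'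
        have : (q : ℝ) * (1 / √(q : ℝ)) = √(q : ℝ) := by
          nth_rw 1 [← Real.mul_self_sqrt hq.le]
          field_simp
        linear_combination (B * √(Y : ℝ) * (1 + Real.log Y)) * this

/-- The mollified first moment is given by its diagonal terms. -/
lemma exists_norm_S₁_twisted_sub_le {η : ℝ} (hη : 0 < η) :
    ∃ C : ℝ, 0 ≤ C ∧ ∀ (q : ℕ) [NeZero q], 2 ≤ q → ∀ (Y : ℕ), Y ≤ q → ∀ (c : ℕ × ℕ → ℂ) (B : ℝ),
      0 ≤ B → (∀ p ∈ pairs Y, ‖c p‖ ≤ B) →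
      ‖S₁ q (twisted c Y) - (phiPlus q : ℂ) *
          ∑ p ∈ (pairs Y).filter (fun p => p.2 ∣ p.1 ∧ p.1.Coprime q), c p / (p.1 : ℂ)‖
        ≤ C * B * (q : ℝ) ^ η * √((q * Y : ℕ) : ℝ) := by
  -- Four factors `q^δ` are spent: one on the number of `w ∣ q`, two on `d(N)` with `N ≤ q²`, one on
  -- the logarithm.
  obtain ⟨δ, hδ⟩ : ∃ δ, δ = η / 4 := ⟨_, rfl⟩
  have hδ0 : 0 < δ := by rw [hδ]; positivity
  obtain ⟨D, hD0, hD⟩ := exists_card_divisors_le hδ0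
  refine ⟨32 * D ^ 2 * (1 + 2 / δ) + (1 + 2 / δ), by positivity, ?_⟩
  intro q _ hq Y hY c B hB hc
  obtain ⟨h, hh, hL⟩ := exists_LFunction_half_eq q
  have hq1 : (1 : ℝ) ≤ q := by exact_mod_cast (by omega : 1 ≤ q)
  set t := (q : ℝ) ^ δ with ht
  have ht1 : 1 ≤ t := Real.one_le_rpow hq1 hδ0.le
  have ht4 : (q : ℝ) ^ η = t ^ 4 := by
    rw [ht, ← Real.rpow_natCast, ← Real.rpow_mul (by linarith)]
    congr 1
    rw [hδ]; push_cast; ring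
  have hlogq : Real.log q ≤ t / δ := Real.log_le_rpow_div (by linarith) hδ0
  have hlog (Z : ℕ) (hZ : Z ≤ q * q) : 1 + Real.log Z ≤ (1 + 2 / δ) * t := by
    have : Real.log Z ≤ 2 * Real.log q := by
      rcases Nat.eq_zero_or_pos Z with rfl | hZ0
      · simpa using Real.log_nonneg hq1
      · calc Real.log Z ≤ Real.log ((q * q : ℕ) : ℝ) :=
              Real.log_le_log (by exact_mod_cast hZ0) (by exact_mod_cast hZ)
          _ = _ := by rw [Nat.cast_mul, Real.log_mul (by linarith) (by linarith)]; ring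
    calc 1 + Real.log Z ≤ t + 2 * (t / δ) := by linarith
      _ = _ := by ring
  obtain ⟨Z, hZ⟩ : ∃ Z, Z = q * Y := ⟨_, rfl⟩
  have hZq : Z ≤ q * q := hZ ▸ Nat.mul_le_mul_left q hY
  have hZdiv : ∀ N : ℕ, N ≤ Z → (N.divisors.card : ℝ) ≤ D * t ^ 2 := by
    intro N hN
    refine (hD N).trans ?_
    gcongr
    calc (N : ℝ) ^ δ ≤ ((q * q : ℕ) : ℝ) ^ δ := by
          gcongr
          exact hN.trans hZq
      _ = t ^ 2 := by
          rw [Nat.cast_mul, Real.mul_rpow (by linarith) (by linarith), pow_two]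
  have hinner : ∀ w ∈ q.divisors, (w : ℝ) * ∑ r ∈ pairs Z, (r.2.divisors.card : ℝ) *
          (offDiag w r.1 r.2 * (1 / √(r.1 : ℝ) * (1 / √(r.2 : ℝ))))
      ≤ 16 * D * (1 + 2 / δ) * t ^ 3 * √(Z : ℝ) := by
    intro w hw
    have hw0 : 0 < w := Nat.pos_of_mem_divisors hw
    have hw0' : (0 : ℝ) < w := by exact_mod_cast hw0
    calc _ ≤ (w : ℝ) * ∑ r ∈ pairs Z, D * t ^ 2 *
          (offDiag w r.1 r.2 * (1 / √(r.1 : ℝ) * (1 / √(r.2 : ℝ)))) := by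
          gcongr with r hr
          · exact mul_nonneg (offDiag_nonneg _ _ _) (by positivity)
          · obtain ⟨h1, h2, h3⟩ := mem_pairs.1 hr
            exact hZdiv _ (by nlinarith)
      _ ≤ (w : ℝ) * (D * t ^ 2 * (16 / w * √(Z : ℝ) * ((1 + 2 / δ) * t))) := by
          rw [← Finset.mul_sum]
          gcongr
          refine (sum_pairs_offDiag_le hw0 Z).trans ?_
          gcongr
          exact hlog Z hZq
      _ = _ := by field_simp
  have hoff := norm_S₁_twisted_sub_le hq hh hL hc hB
  have hdiag := norm_diagonal_sub_le hh hY hc hB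
  rw [← hZ] at hoff hdiag ⊢
  have hoff' : 2 * B * ∑ w ∈ q.divisors, (w : ℝ) * ∑ r ∈ pairs Z, (r.2.divisors.card : ℝ) *
          (offDiag w r.1 r.2 * (1 / √(r.1 : ℝ) * (1 / √(r.2 : ℝ))))
      ≤ 32 * D ^ 2 * (1 + 2 / δ) * B * t ^ 4 * √(Z : ℝ) := by
    refine (mul_le_mul_of_nonneg_left (Finset.sum_le_sum hinner) (by positivity)).trans ?_
    rw [Finset.sum_const, nsmul_eq_mul]
    calc 2 * B * ((q.divisors.card : ℝ) * (16 * D * (1 + 2 / δ) * t ^ 3 * √(Z : ℝ)))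
        ≤ 2 * B * (D * t * (16 * D * (1 + 2 / δ) * t ^ 3 * √(Z : ℝ))) := by
          have h0 : 0 ≤ 16 * D * (1 + 2 / δ) * t ^ 3 * √(Z : ℝ) := by positivity
          exact mul_le_mul_of_nonneg_left (mul_le_mul_of_nonneg_right (hD q) h0) (by positivity)
      _ = _ := by ring
  have hdiag' : B * √(Z : ℝ) * (1 + Real.log Y) ≤ (1 + 2 / δ) * B * t ^ 4 * √(Z : ℝ) := by
    calc _ ≤ B * √(Z : ℝ) * ((1 + 2 / δ) * t ^ 4) := by
          gcongr
          refine (hlog Y (hY.trans (Nat.le_mul_self q))).trans ?_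
          gcongr
          exact le_self_pow₀ ht1 (by norm_num)
      _ = _ := by ring
  rw [ht4]
  refine (norm_sub_le_norm_sub_add_norm_sub _ _ _).trans
    ((add_le_add (hoff.trans hoff') (hdiag.trans hdiag')).trans (le_of_eq ?_))
  ring

/-! ### Mertens' theorem and partial summation over primes -/

open ArithmeticFunction in
lemma sum_vonMangoldt_mul_div (N : ℕ) :
    ∑ n ∈ Finset.Ioc 0 N, vonMangoldt n * ((N / n : ℕ) : ℝ) = Real.log (N.factorial : ℝ) := by
  rw [← sum_Ioc_mul_zeta_eq_sum, vonMangoldt_mul_zeta]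
  induction N with
  | zero => simp
  | succ N ih =>
    rw [Finset.sum_Ioc_succ_top (by omega), ih, Nat.factorial_succ, Nat.cast_mul,
      Real.log_mul (by positivity) (by positivity), log_apply, add_comm]

open ArithmeticFunction in
/-- Mertens' first theorem for the von Mangoldt function. -/
lemma exists_abs_sum_vonMangoldt_div_sub_log_le :
    ∃ C : ℝ, ∀ N : ℕ, 1 ≤ N → |∑ n ∈ Finset.Ioc 0 N, vonMangoldt n / n - Real.log N| ≤ C := by
  -- Chebyshev's bound `ψ(N) ≤ (log 4 + 4) N` pays for replacing `⌊N/n⌋` by `N/n` in the upper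
  -- estimate; the `1` comes from `log N! ≥ N log N - N` in the lower one.
  refine ⟨Real.log 4 + 4 + 1, fun N hN => ?_⟩
  have hN0 : (0 : ℝ) < N := by exact_mod_cast hN
  have hN1 : (1 : ℝ) ≤ N := by exact_mod_cast hN
  have hfac := sum_vonMangoldt_mul_div N
  have hpsi : ∑ n ∈ Finset.Ioc 0 N, vonMangoldt n ≤ (Real.log 4 + 4) * N := by
    have := Chebyshev.psi_le_const_mul_self hN0.le
    rwa [Chebyshev.psi, Nat.floor_natCast] at this
  have hup : Real.log (N.factorial : ℝ) ≤ N * Real.log N := by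
    rw [← Real.log_pow]
    exact Real.log_le_log (by exact_mod_cast N.factorial_pos) (by exact_mod_cast N.factorial_le_pow)
  have hlow : N * Real.log N - N ≤ Real.log (N.factorial : ℝ) := by
    have h1 := Stirling.le_log_factorial_stirling (n := N) (by omega)
    have h2 : 0 ≤ Real.log N := Real.log_nonneg hN1
    have h3 : 0 ≤ Real.log (2 * Real.pi) := Real.log_nonneg (by nlinarith [Real.pi_gt_three])
    linarith
  have hle : ∑ n ∈ Finset.Ioc 0 N, vonMangoldt n * ((N / n : ℕ) : ℝ)
      ≤ N * ∑ n ∈ Finset.Ioc 0 N, vonMangoldt n / n := by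
    rw [Finset.mul_sum]
    refine Finset.sum_le_sum fun n _ => ?_
    calc _ ≤ vonMangoldt n * ((N : ℝ) / n) := by
          gcongr
          exact Nat.cast_div_le
      _ = _ := by ring
  have hge : N * ∑ n ∈ Finset.Ioc 0 N, vonMangoldt n / n
      ≤ ∑ n ∈ Finset.Ioc 0 N, vonMangoldt n * ((N / n : ℕ) : ℝ)
        + ∑ n ∈ Finset.Ioc 0 N, vonMangoldt n := by
    rw [Finset.mul_sum, ← Finset.sum_add_distrib]
    refine Finset.sum_le_sum fun n hn => ?_
    have hn0 : 0 < n := (Finset.mem_Ioc.1 hn).1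
    have h1 : (N : ℝ) / n ≤ ((N / n : ℕ) : ℝ) + 1 := by
      rw [div_le_iff₀ (by exact_mod_cast hn0)]
      have := Nat.lt_div_mul_add (a := N) hn0
      have h2 : N ≤ (N / n + 1) * n := by rw [add_mul, one_mul]; exact this.le
      exact_mod_cast h2
    calc N * (vonMangoldt n / n) = vonMangoldt n * ((N : ℝ) / n) := by ring
      _ ≤ vonMangoldt n * (((N / n : ℕ) : ℝ) + 1) := by
          gcongr
      _ = _ := by ring
  set S := ∑ n ∈ Finset.Ioc 0 N, vonMangoldt n / n
  have h4 : 0 ≤ Real.log 4 := Real.log_nonneg (by norm_num)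
  rw [abs_le]
  constructor
  · have : N * (-1) ≤ N * (S - Real.log N) := by linarith
    linarith [le_of_mul_le_mul_left this hN0]
  · have : N * (S - Real.log N) ≤ N * (Real.log 4 + 4) := by linarith
    linarith [le_of_mul_le_mul_left this hN0]

/-- `log p / p` at primes `p`, and zero elsewhere. -/
noncomputable def primeLogDiv (n : ℕ) : ℝ := if n.Prime then Real.log n / n else 0

lemma primeLogDiv_nonneg (n : ℕ) : 0 ≤ primeLogDiv n := by
  unfold primeLogDiv
  split_ifs
  · exact div_nonneg (Real.log_natCast_nonneg n) (Nat.cast_nonneg n)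
  · exact le_rfl

open ArithmeticFunction in
lemma summable_vonMangoldt_nonprime :
    Summable fun n : ℕ => (if n.Prime then 0 else vonMangoldt n) / (n : ℝ) := by
  -- Modulo `1` there is a single residue class, so the restriction is empty.
  have := vonMangoldt.summable_residueClass_non_primes_div (q := 1) 0
  refine this.congr fun n => ?_
  congr 2
  rw [vonMangoldt.residueClass, Set.indicator_of_mem]
  exact Subsingleton.elim _ _

open ArithmeticFunction in
lemma vonMangoldt_div_eq (n : ℕ) : vonMangoldt n / n
    = primeLogDiv n + (if n.Prime then 0 else vonMangoldt n) / (n : ℝ) := by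
  unfold primeLogDiv
  split_ifs with h
  · rw [vonMangoldt_apply_prime h]; simp
  · simp

/-- Mertens' first theorem. -/
lemma exists_abs_sum_primeLogDiv_sub_log_le :
    ∃ C : ℝ, 0 ≤ C ∧ ∀ t : ℝ, 1 ≤ t →
      |∑ n ∈ Finset.Icc 0 ⌊t⌋₊, primeLogDiv n - Real.log t| ≤ C := by
  obtain ⟨C, hC⟩ := exists_abs_sum_vonMangoldt_div_sub_log_le
  set K := ∑' n : ℕ, (if n.Prime then 0 else ArithmeticFunction.vonMangoldt n) / (n : ℝ) with hK
  have hnn : ∀ n : ℕ, 0 ≤ (if n.Prime then 0 else ArithmeticFunction.vonMangoldt n) / (n : ℝ) := by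
    intro n
    split_ifs
    · simp
    · exact div_nonneg ArithmeticFunction.vonMangoldt_nonneg (Nat.cast_nonneg n)
  have hC0 : 0 ≤ C := (abs_nonneg _).trans (hC 1 le_rfl)
  have hK0 : 0 ≤ K := tsum_nonneg hnn
  refine ⟨C + K + 1, by positivity, fun t ht => ?_⟩
  have hN : 1 ≤ ⌊t⌋₊ := (Nat.one_le_floor_iff t).2 ht
  set N := ⌊t⌋₊ with hNdef
  have hN0 : (0 : ℝ) < N := by exact_mod_cast hN
  have hsplit : ∑ n ∈ Finset.Icc 0 N, primeLogDiv n
      = ∑ n ∈ Finset.Ioc 0 N, ArithmeticFunction.vonMangoldt n / n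
        - ∑ n ∈ Finset.Ioc 0 N,
          (if n.Prime then 0 else ArithmeticFunction.vonMangoldt n) / (n : ℝ) := by
    rw [← Finset.sum_sub_distrib, ← Finset.add_sum_Ioc_eq_sum_Icc (Nat.zero_le N)]
    have : primeLogDiv 0 = 0 := by simp [primeLogDiv]
    rw [this, zero_add]
    refine Finset.sum_congr rfl fun n _ => ?_
    rw [vonMangoldt_div_eq]; ring
  have h1 := hC N hN
  have h2 : ∑ n ∈ Finset.Ioc 0 N,
      (if n.Prime then 0 else ArithmeticFunction.vonMangoldt n) / (n : ℝ) ≤ K :=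
    summable_vonMangoldt_nonprime.sum_le_tsum _ (fun n _ => hnn n)
  have h3 : 0 ≤ ∑ n ∈ Finset.Ioc 0 N,
      (if n.Prime then 0 else ArithmeticFunction.vonMangoldt n) / (n : ℝ) :=
    Finset.sum_nonneg fun n _ => hnn n
  have h4 : Real.log N ≤ Real.log t := Real.log_le_log hN0 (Nat.floor_le (by linarith))
  have h5 : Real.log t ≤ Real.log N + 1 := by
    have : t ≤ 2 * N := by
      have := Nat.lt_floor_add_one t
      have h : (1 : ℝ) ≤ N := by exact_mod_cast hN
      linarith
    have h6 := Real.log_le_log (by linarith) this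
    rw [Real.log_mul (by norm_num) hN0.ne'] at h6
    linarith [Real.log_two_lt_d9]
  rw [abs_le] at h1 ⊢
  rw [hsplit]
  constructor <;> linarith [h1.1, h1.2]

lemma eval_weight_hasDerivAt (Q : ℝ[X]) {l t : ℝ} (ht : t ≠ 0) :
    HasDerivAt (fun t => Q.eval ((l - Real.log t) / l))
      (Q.derivative.eval ((l - Real.log t) / l) * (-t⁻¹ / l)) t := by
  have h1 : HasDerivAt (fun t => (l - Real.log t) / l) (-t⁻¹ / l) t := by
    have := ((Real.hasDerivAt_log ht).const_sub l).div_const l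
    simpa using this
  exact (Q.hasDerivAt _).comp t h1

lemma primitiveOf_hasDerivAt (Q : ℝ[X]) (x : ℝ) : HasDerivAt (primitiveOf Q) (Q.eval x) x :=
  intervalIntegral.integral_hasDerivAt_right (Q.continuous.intervalIntegrable _ _)
    Q.continuous.stronglyMeasurable.stronglyMeasurableAtFilter Q.continuous.continuousAt

lemma exists_abs_eval_le (Q : ℝ[X]) : ∃ K : ℝ, 0 ≤ K ∧ ∀ u ∈ Set.Icc (0 : ℝ) 1, |Q.eval u| ≤ K := by
  obtain ⟨K, hK⟩ := isCompact_Icc.exists_bound_of_continuousOn (s := Set.Icc (0 : ℝ) 1)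
    Q.continuous.continuousOn
  exact ⟨K, (norm_nonneg _).trans (hK 0 (by simp)), hK⟩

lemma log_ratio_mem {y t : ℝ} (hy : 1 < y) (ht : t ∈ Set.Icc 1 y) :
    (Real.log y - Real.log t) / Real.log y ∈ Set.Icc (0 : ℝ) 1 := by
  have hl : 0 < Real.log y := Real.log_pos hy
  have h1 : 0 ≤ Real.log t := Real.log_nonneg ht.1
  have h2 : Real.log t ≤ Real.log y := Real.log_le_log (by linarith [ht.1]) ht.2
  constructor
  · exact div_nonneg (by linarith) hl.le
  · rw [div_le_one hl]; linarith

open MeasureTheory in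
/-- Partial summation against the prime logarithm sum. -/
lemma exists_abs_sum_primeLogDiv_eval_sub_le (Q : ℝ[X]) (hQ : Q.eval 0 = 0) :
    ∃ C : ℝ, 0 ≤ C ∧ ∀ y : ℝ, 1 < y →
      |∑ k ∈ Finset.Icc 0 ⌊y⌋₊, Q.eval ((Real.log y - Real.log k) / Real.log y) * primeLogDiv k
        - Real.log y * primitiveOf Q 1| ≤ C := by
  obtain ⟨C, hC0, hC⟩ := exists_abs_sum_primeLogDiv_sub_log_le
  obtain ⟨K, hK0, hK⟩ := exists_abs_eval_le Q.derivative
  refine ⟨K * C, by positivity, fun y hy => ?_⟩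
  set l := Real.log y with hl
  have hl0 : 0 < l := Real.log_pos hy
  set f : ℝ → ℝ := fun t => Q.eval ((l - Real.log t) / l) with hf
  set f' : ℝ → ℝ := fun t => Q.derivative.eval ((l - Real.log t) / l) * (-t⁻¹ / l) with hf'
  have hne : ∀ t ∈ Set.Icc 1 y, t ≠ 0 := fun t ht => by linarith [ht.1]
  have hder : ∀ t ∈ Set.Icc 1 y, HasDerivAt f (f' t) t := fun t ht =>
    eval_weight_hasDerivAt Q (hne t ht)
  have hcont : ContinuousOn f' (Set.Icc 1 y) := by
    have hlog : ContinuousOn Real.log (Set.Icc 1 y) := Real.continuousOn_log.mono fun t ht => hne t ht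
    refine ContinuousOn.mul (Q.derivative.continuous.comp_continuousOn ?_) ?_
    · exact (continuousOn_const.sub hlog).div_const l
    · exact (continuousOn_id.inv₀ hne).neg.div_const l
  have hint : IntegrableOn f' (Set.Icc 1 y) := hcont.integrableOn_Icc
  have hderiv : Set.EqOn (deriv f) f' (Set.Icc 1 y) := fun t ht => (hder t ht).deriv
  have hint' : IntegrableOn (deriv f) (Set.Icc 1 y) :=
    hint.congr_fun hderiv.symm measurableSet_Icc
  have habel := sum_mul_eq_sub_integral_mul₀ (f := f) primeLogDiv (by simp [primeLogDiv]) y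
    (fun t ht => (hder t ht).differentiableAt) hint'
  -- Vanishing of `Q` at `0` removes the boundary term at `y`.
  have hfy : f y = 0 := by simp [hf, hl, hQ]
  have hsubset : Set.Ioc 1 y ⊆ Set.Icc 1 y := Set.Ioc_subset_Icc_self
  have hcongr : ∫ t in Set.Ioc 1 y, deriv f t * ∑ k ∈ Finset.Icc 0 ⌊t⌋₊, primeLogDiv k
      = ∫ t in Set.Ioc 1 y, f' t * ∑ k ∈ Finset.Icc 0 ⌊t⌋₊, primeLogDiv k :=
    setIntegral_congr_fun measurableSet_Ioc fun t ht => by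
      simp only [hderiv (hsubset ht)]
  have hI1 : IntegrableOn (fun t => f' t * ∑ k ∈ Finset.Icc 0 ⌊t⌋₊, primeLogDiv k)
      (Set.Ioc 1 y) :=
    (integrableOn_mul_sum_Icc primeLogDiv zero_le_one hint).mono_set hsubset
  have hlogc : ContinuousOn Real.log (Set.Icc 1 y) :=
    Real.continuousOn_log.mono fun t ht => hne t ht
  have hI2' : ContinuousOn (fun t => f' t * Real.log t) (Set.Icc 1 y) := hcont.mul hlogc
  have hI2 : IntegrableOn (fun t => f' t * Real.log t) (Set.Ioc 1 y) :=
    hI2'.integrableOn_Icc.mono_set hsubset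
  have hmain : ∫ t in Set.Ioc 1 y, f' t * Real.log t = - (l * primitiveOf Q 1) := by
    rw [← intervalIntegral.integral_of_le hy.le]
    -- In this antiderivative the added multiple of `Q₁` cancels the `f(t)/t` left by
    -- differentiating `log`. It vanishes at `y` and equals `l Q₁(1)` at `1`.
    have hF : ∀ t ∈ Set.uIcc 1 y, HasDerivAt
        (fun t => f t * Real.log t + l * primitiveOf Q ((l - Real.log t) / l))
        (f' t * Real.log t) t := by
      intro t ht
      rw [Set.uIcc_of_le hy.le] at ht
      have h1 := (hder t ht).mul (Real.hasDerivAt_log (hne t ht))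
      have h2 : HasDerivAt (fun t => (l - Real.log t) / l) (-t⁻¹ / l) t := by
        simpa using ((Real.hasDerivAt_log (hne t ht)).const_sub l).div_const l
      have h3 := ((primitiveOf_hasDerivAt Q ((l - Real.log t) / l)).comp t h2).const_mul l
      refine (h1.add h3).congr_deriv ?_
      simp only [hf]
      field_simp
      ring
    rw [intervalIntegral.integral_eq_sub_of_hasDerivAt hF
      ((hI2'.mono (by rw [Set.uIcc_of_le hy.le])).intervalIntegrable)]
    rw [hfy]
    have h0 : primitiveOf Q 0 = 0 := by simp [primitiveOf]
    simp [← hl, h0, hl0.ne']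
  have hbound : |∫ t in Set.Ioc 1 y, (f' t * ∑ k ∈ Finset.Icc 0 ⌊t⌋₊, primeLogDiv k
      - f' t * Real.log t)| ≤ K * C := by
    -- The factor `1/l` from `f'` cancels `∫ dt/t = l`, so the Mertens error stays bounded uniformly
    -- in `y`.
    have hinv : ∫ t in Set.Ioc 1 y, K * C / l * t⁻¹ = K * C := by
      rw [← intervalIntegral.integral_of_le hy.le, intervalIntegral.integral_const_mul,
        integral_inv_of_pos one_pos (by linarith), div_one, ← hl]
      field_simp
    rw [← hinv, ← Real.norm_eq_abs]
    have hg : IntegrableOn (fun t : ℝ => K * C / l * t⁻¹) (Set.Ioc 1 y) := by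
      refine IntegrableOn.mono_set ?_ hsubset
      exact (continuousOn_const.mul (continuousOn_id.inv₀ hne)).integrableOn_Icc
    refine norm_integral_le_of_norm_le hg ?_
    refine (ae_restrict_iff' measurableSet_Ioc).2 (Filter.Eventually.of_forall fun t ht => ?_)
    have ht0 : 0 < t := by linarith [ht.1]
    have ht' := hsubset ht
    rw [← mul_sub, norm_mul, Real.norm_eq_abs, Real.norm_eq_abs, hf']
    simp only
    rw [abs_mul, abs_div, abs_neg, abs_of_pos (inv_pos.2 ht0), abs_of_pos hl0]
    calc _ ≤ K * (t⁻¹ / l) * C := by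
          gcongr
          · exact hK _ (log_ratio_mem hy ht')
          · exact hC t ht.1.le
      _ = _ := by ring
  rw [integral_sub hI1 hI2, hmain] at hbound
  have hfinal : ∑ k ∈ Finset.Icc 0 ⌊y⌋₊, Q.eval ((l - Real.log k) / l) * primeLogDiv k
      - l * primitiveOf Q 1
      = -((∫ t in Set.Ioc 1 y, f' t * ∑ k ∈ Finset.Icc 0 ⌊t⌋₊, primeLogDiv k)
        - -(l * primitiveOf Q 1)) := by
    have : ∑ k ∈ Finset.Icc 0 ⌊y⌋₊, Q.eval ((l - Real.log k) / l) * primeLogDiv k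
      = ∑ k ∈ Finset.Icc 0 ⌊y⌋₊, f k * primeLogDiv k := rfl
    rw [this, habel, hfy, hcongr]
    ring
  rw [hfinal, abs_neg]
  exact hbound

/-- The sum of `log p / p` over the primes dividing `q`. -/
lemma exists_sum_primeLogDiv_dvd_le :
    ∃ C : ℝ, 0 ≤ C ∧ ∀ q : ℕ, 2 ≤ q →
      ∑ p ∈ q.divisors, primeLogDiv p ≤ Real.log (1 + Real.log q) + C := by
  obtain ⟨C, hC0, hC⟩ := exists_abs_sum_primeLogDiv_sub_log_le
  refine ⟨C + 1, by positivity, fun q hq => ?_⟩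
  have hL : 0 < Real.log q := Real.log_pos (by exact_mod_cast hq)
  -- Primes up to `z` are handled by Mertens. For larger ones `log p / p ≤ Λ(p)/z`, and `∑_{d ∣ q}
  -- Λ(d) = log q ≤ z` bounds their total by `1`.
  set z := 1 + Real.log q with hz
  have hz1 : 1 ≤ z := by linarith
  have hterm : ∀ p ∈ q.divisors, primeLogDiv p ≤
      (if p ∈ Finset.Icc 0 ⌊z⌋₊ then primeLogDiv p else 0)
        + ArithmeticFunction.vonMangoldt p / z := by
    intro p hp
    split_ifs with h
    · have := div_nonneg (ArithmeticFunction.vonMangoldt_nonneg (n := p)) (by linarith : 0 ≤ z)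
      linarith
    · rw [zero_add]
      have hzp : z < p := by
        simp only [Finset.mem_Icc, Nat.zero_le, true_and, not_le] at h
        exact (Nat.floor_lt (by linarith)).1 h
      unfold primeLogDiv
      split_ifs with hpr
      · rw [ArithmeticFunction.vonMangoldt_apply_prime hpr]
        have := Real.log_natCast_nonneg p
        gcongr
      · exact div_nonneg ArithmeticFunction.vonMangoldt_nonneg (by linarith)
  refine (Finset.sum_le_sum hterm).trans ?_
  rw [Finset.sum_add_distrib, ← Finset.sum_div, ArithmeticFunction.vonMangoldt_sum,
    ← Finset.sum_filter]
  have h1 : ∑ p ∈ q.divisors.filter (· ∈ Finset.Icc 0 ⌊z⌋₊), primeLogDiv p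
      ≤ ∑ p ∈ Finset.Icc 0 ⌊z⌋₊, primeLogDiv p :=
    Finset.sum_le_sum_of_subset_of_nonneg (fun p hp => (Finset.mem_filter.1 hp).2)
      fun p _ _ => primeLogDiv_nonneg p
  have h2 := (abs_le.1 (hC z hz1)).2
  have h3 : Real.log q / z ≤ 1 := (div_le_one (by linarith)).2 (by linarith)
  linarith

/-! ### The diagonal of the second piece -/

lemma logConvMu_eq : logConvMu = ArithmeticFunction.vonMangoldt :=
  ArithmeticFunction.log_mul_moebius_eq_vonMangoldt

lemma weight_eq (Q : ℝ[X]) {y : ℝ} (hy : 0 < y) {m : ℕ} (hm : 1 ≤ m) :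
    weight Q y m = Q.eval ((Real.log y - Real.log m) / Real.log y) := by
  rw [weight, Real.log_div hy.ne' (by exact_mod_cast (by omega : m ≠ 0))]

lemma abs_weight_le {Q : ℝ[X]} {K : ℝ} (hK : ∀ u ∈ Set.Icc (0 : ℝ) 1, |Q.eval u| ≤ K)
    {y : ℝ} (hy : 1 < y) {m : ℕ} (hm : 1 ≤ m) (hmy : m ≤ ⌊y⌋₊) : |weight Q y m| ≤ K := by
  rw [weight_eq Q (by linarith) hm]
  exact hK _ (log_ratio_mem hy ⟨by exact_mod_cast hm, (Nat.le_floor_iff (by linarith)).1 hmy⟩)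

/-- The weight, cut off beyond `y`. -/
noncomputable def cutWeight (Q : ℝ[X]) (y : ℝ) (n : ℕ) : ℝ :=
  if n ≤ ⌊y⌋₊ then weight Q y n else 0

lemma abs_cutWeight_le {Q : ℝ[X]} {K : ℝ} (hK : ∀ u ∈ Set.Icc (0 : ℝ) 1, |Q.eval u| ≤ K)
    (hK0 : 0 ≤ K) {y : ℝ} (hy : 1 < y) {m : ℕ} (hm : 1 ≤ m) : |cutWeight Q y m| ≤ K := by
  unfold cutWeight
  split_ifs with h
  · exact abs_weight_le hK hy hm h
  · simpa using hK0

lemma sum_divisors_prime_pow_moebius {p k : ℕ} (hp : p.Prime) (hk : 0 < k) (g : ℕ → ℝ) :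
    ∑ n ∈ (p ^ k).divisors, (ArithmeticFunction.moebius n : ℝ) * g n = g 1 - g p := by
  obtain ⟨j, rfl⟩ : ∃ j, k = j + 1 := ⟨k - 1, by omega⟩
  rw [Nat.sum_divisors_prime_pow hp, Finset.sum_range_succ', Finset.sum_range_succ',
    Finset.sum_eq_zero]
  · simp [ArithmeticFunction.moebius_apply_prime hp]
    ring
  · intro i _
    rw [ArithmeticFunction.moebius_apply_prime_pow hp (by omega), if_neg (by omega)]
    simp

/-- The cutoff in `cutWeight` absorbs the condition `mn ≤ y`, which frees the inner sum to run over
all divisors of `m`, where `μ` can be exploited. -/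
lemma sum_diagonal_eq (Q : ℝ[X]) (y : ℝ) (q : ℕ) :
    ∑ p ∈ (pairs ⌊y⌋₊).filter (fun p => p.2 ∣ p.1 ∧ p.1.Coprime q),
      logConvMu p.1 * (ArithmeticFunction.moebius p.2 : ℝ) * weight Q y (p.1 * p.2) / (p.1 : ℝ)
    = ∑ m ∈ Finset.Icc 1 ⌊y⌋₊, if m.Coprime q then ArithmeticFunction.vonMangoldt m / m *
        ∑ n ∈ m.divisors, (ArithmeticFunction.moebius n : ℝ) * cutWeight Q y (m * n) else 0 := by
  rw [Finset.sum_filter, sum_pairs ⌊y⌋₊ fun m n => if n ∣ m ∧ m.Coprime q then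
    logConvMu m * (ArithmeticFunction.moebius n : ℝ) * weight Q y (m * n) / (m : ℝ) else 0]
  refine Finset.sum_congr rfl fun m hm => ?_
  rw [Finset.mem_Icc] at hm
  split_ifs with hc
  · rw [← Finset.sum_filter, Finset.mul_sum]
    have hset : m.divisors.filter (fun n => m * n ≤ ⌊y⌋₊)
        = (Finset.Icc 1 (⌊y⌋₊ / m)).filter (fun n => n ∣ m ∧ m.Coprime q) := by
      ext n
      simp only [Finset.mem_filter, Nat.mem_divisors, Finset.mem_Icc, Nat.le_div_iff_mul_le hm.1]
      constructor
      · rintro ⟨⟨h1, h2⟩, h3⟩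
        exact ⟨⟨Nat.pos_of_dvd_of_pos h1 hm.1, by rwa [mul_comm]⟩, h1, hc⟩
      · rintro ⟨⟨h1, h2⟩, h3, -⟩
        exact ⟨⟨h3, by omega⟩, by rwa [mul_comm]⟩
    rw [← hset, Finset.sum_filter]
    refine Finset.sum_congr rfl fun n _ => ?_
    unfold cutWeight
    rw [logConvMu_eq]
    split_ifs
    · ring
    · simp
  · simp [hc]

lemma sum_primeLogDiv_cutWeight (Q : ℝ[X]) {y : ℝ} (hy : 1 < y) :
    ∑ m ∈ Finset.Icc 1 ⌊y⌋₊, primeLogDiv m * cutWeight Q y m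
      = ∑ k ∈ Finset.Icc 0 ⌊y⌋₊, Q.eval ((Real.log y - Real.log k) / Real.log y)
          * primeLogDiv k := by
  have h0 : primeLogDiv 0 = 0 := by simp [primeLogDiv]
  rw [← Finset.add_sum_Ioc_eq_sum_Icc (Nat.zero_le _), h0, mul_zero, zero_add]
  refine Finset.sum_congr rfl fun m hm => ?_
  rw [Finset.mem_Ioc] at hm
  rw [cutWeight, if_pos hm.2, weight_eq Q (by linarith) hm.1, mul_comm]

/-- Since `(log y - 2 log m)/log y = (log √y - log m)/log √y`, the weight of `m²` at height `y` is
that of `m` at height `√y`. The same asymptotic then applies with half the logarithm. -/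
lemma sum_primeLogDiv_cutWeight_sq (Q : ℝ[X]) {y : ℝ} (hy : 1 < y) :
    ∑ m ∈ Finset.Icc 1 ⌊y⌋₊, primeLogDiv m * cutWeight Q y (m * m)
      = ∑ k ∈ Finset.Icc 0 ⌊√y⌋₊, Q.eval ((Real.log √y - Real.log k) / Real.log √y)
          * primeLogDiv k := by
  have h0 : primeLogDiv 0 = 0 := by simp [primeLogDiv]
  have hy0 : 0 ≤ y := by linarith
  rw [← Finset.add_sum_Ioc_eq_sum_Icc (Nat.zero_le _), h0, mul_zero, zero_add]
  have hiff (m : ℕ) : m * m ≤ ⌊y⌋₊ ↔ m ≤ ⌊√y⌋₊ := by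
    rw [Nat.le_floor_iff hy0, Nat.le_floor_iff (Real.sqrt_nonneg y),
      Real.le_sqrt (Nat.cast_nonneg m) hy0, pow_two, Nat.cast_mul]
  symm
  have hsub : Finset.Ioc 0 ⌊√y⌋₊ ⊆ Finset.Icc 1 ⌊y⌋₊ := by
    intro m hm
    rw [Finset.mem_Ioc] at hm
    rw [Finset.mem_Icc]
    exact ⟨hm.1, (Nat.le_mul_self m).trans ((hiff m).2 hm.2)⟩
  refine Finset.sum_subset_zero_on_sdiff hsub ?_ ?_
  · intro m hm
    simp only [Finset.mem_sdiff, Finset.mem_Icc, Finset.mem_Ioc, not_and, not_le] at hm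
    rw [cutWeight, if_neg, mul_zero]
    rw [hiff, not_le]
    exact hm.2 hm.1.1
  · intro m hm
    rw [Finset.mem_Ioc] at hm
    have hm0 : (m : ℝ) ≠ 0 := by exact_mod_cast (by omega : m ≠ 0)
    rw [cutWeight, if_pos ((hiff m).2 hm.2), weight_eq Q (by linarith) (Nat.mul_pos hm.1 hm.1),
      Nat.cast_mul, Real.log_mul hm0 hm0, Real.log_sqrt hy0, mul_comm]
    congr 2
    have := (Real.log_pos hy).ne'
    field_simp
    ring

open ArithmeticFunction in
-- At a prime coprime to `q` the approximation is exact. A prime dividing `q` has no true term and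
-- costs the whole approximant; a proper prime power costs at most its true term, and elsewhere `Λ`
-- vanishes.
lemma abs_diagonal_term_sub_le {Q : ℝ[X]} {K : ℝ} (hK : ∀ u ∈ Set.Icc (0 : ℝ) 1, |Q.eval u| ≤ K)
    (hK0 : 0 ≤ K) {y : ℝ} (hy : 1 < y) (q : ℕ) {m : ℕ} (hm : 1 ≤ m) :
    |(if m.Coprime q then vonMangoldt m / m *
        ∑ n ∈ m.divisors, (moebius n : ℝ) * cutWeight Q y (m * n) else 0)
      - (primeLogDiv m * cutWeight Q y m - primeLogDiv m * cutWeight Q y (m * m))|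
    ≤ 2 * K * ((if m.Prime then 0 else vonMangoldt m) / (m : ℝ))
      + 2 * K * (if m ∣ q then primeLogDiv m else 0) := by
  have hdiff {a b : ℕ} (ha : 1 ≤ a) (hb : 1 ≤ b) :
      |cutWeight Q y a - cutWeight Q y b| ≤ 2 * K := by
    have h1 := abs_le.1 (abs_cutWeight_le hK hK0 hy ha)
    have h2 := abs_le.1 (abs_cutWeight_le hK hK0 hy hb)
    rw [abs_le]
    constructor <;> linarith [h1.1, h1.2, h2.1, h2.2]
  have hinner {p k : ℕ} (hp : p.Prime) (hk : 0 < k) :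
      ∑ n ∈ (p ^ k).divisors, (moebius n : ℝ) * cutWeight Q y (p ^ k * n)
        = cutWeight Q y (p ^ k) - cutWeight Q y (p ^ k * p) := by
    rw [sum_divisors_prime_pow_moebius hp hk fun n => cutWeight Q y (p ^ k * n), mul_one]
  by_cases hpr : m.Prime
  · have hval : vonMangoldt m / m * ∑ n ∈ m.divisors, (moebius n : ℝ) * cutWeight Q y (m * n)
        = primeLogDiv m * cutWeight Q y m - primeLogDiv m * cutWeight Q y (m * m) := by
      have := hinner hpr one_pos
      rw [pow_one] at this
      rw [this, primeLogDiv, if_pos hpr, vonMangoldt_apply_prime hpr, mul_sub]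
    by_cases hc : m.Coprime q
    · rw [if_pos hc, hval, sub_self, abs_zero]
      have := primeLogDiv_nonneg m
      rw [if_pos hpr, zero_div, mul_zero, zero_add]
      split_ifs
      · positivity
      · simp
    · have hd : m ∣ q := by
        by_contra h
        exact hc ((Nat.Prime.coprime_iff_not_dvd hpr).2 h)
      rw [if_neg hc, if_pos hpr, if_pos hd, zero_sub, abs_neg, ← mul_sub, abs_mul,
        abs_of_nonneg (primeLogDiv_nonneg m), zero_div, mul_zero, zero_add, mul_comm]
      exact mul_le_mul_of_nonneg_right (hdiff hm (Nat.mul_pos hm hm)) (primeLogDiv_nonneg m)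
  · have h0 : primeLogDiv m = 0 := by rw [primeLogDiv, if_neg hpr]
    have hL : 0 ≤ vonMangoldt m / (m : ℝ) := div_nonneg vonMangoldt_nonneg (Nat.cast_nonneg m)
    rw [h0, if_neg hpr]
    simp only [zero_mul, sub_zero, ite_self, mul_zero, add_zero]
    split_ifs with hc
    · by_cases hpp : IsPrimePow m
      · obtain ⟨p, k, hp, hk, rfl⟩ := hpp
        have hp' := hp.nat_prime
        rw [hinner hp' hk, abs_mul, abs_of_nonneg hL, mul_comm]
        exact mul_le_mul_of_nonneg_right (hdiff hm (Nat.mul_pos hm hp'.pos)) hL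
      · have : vonMangoldt m = 0 := by
          by_contra h
          exact hpp (vonMangoldt_ne_zero_iff.1 h)
        simp [this]
    · rw [abs_zero]
      positivity

/-- The diagonal contribution of the second piece. -/
lemma exists_abs_diagonal_sub_le (Q : ℝ[X]) (hQ : Q.eval 0 = 0) :
    ∃ C : ℝ, 0 ≤ C ∧ ∀ (y : ℝ) (q : ℕ), 1 < y → 2 ≤ q →
      |∑ p ∈ (pairs ⌊y⌋₊).filter (fun p => p.2 ∣ p.1 ∧ p.1.Coprime q),
        logConvMu p.1 * (ArithmeticFunction.moebius p.2 : ℝ) * weight Q y (p.1 * p.2) / (p.1 : ℝ)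
        - Real.log y / 2 * primitiveOf Q 1| ≤ C * (1 + Real.log (1 + Real.log q)) := by
  obtain ⟨C₁, hC₁0, hC₁⟩ := exists_abs_sum_primeLogDiv_eval_sub_le Q hQ
  obtain ⟨C₂, hC₂0, hC₂⟩ := exists_sum_primeLogDiv_dvd_le
  obtain ⟨K, hK0, hK⟩ := exists_abs_eval_le Q
  set T := ∑' n : ℕ, (if n.Prime then 0 else ArithmeticFunction.vonMangoldt n) / (n : ℝ) with hT
  have hnn : ∀ n : ℕ, 0 ≤ (if n.Prime then 0 else ArithmeticFunction.vonMangoldt n) / (n : ℝ) := by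
    intro n
    split_ifs
    · simp
    · exact div_nonneg ArithmeticFunction.vonMangoldt_nonneg (Nat.cast_nonneg n)
  have hT0 : 0 ≤ T := tsum_nonneg hnn
  refine ⟨2 * K * T + 2 * K * C₂ + 2 * K + 2 * C₁, by positivity, fun y q hy hq => ?_⟩
  have hlq : 0 < Real.log q := Real.log_pos (by exact_mod_cast hq)
  have hll : 0 ≤ Real.log (1 + Real.log q) := Real.log_nonneg (by linarith)
  rw [sum_diagonal_eq]
  set D := ∑ m ∈ Finset.Icc 1 ⌊y⌋₊, if m.Coprime q then ArithmeticFunction.vonMangoldt m / m *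
        ∑ n ∈ m.divisors, (ArithmeticFunction.moebius n : ℝ) * cutWeight Q y (m * n) else 0 with hD
  have h1 : |D - (∑ m ∈ Finset.Icc 1 ⌊y⌋₊, primeLogDiv m * cutWeight Q y m
      - ∑ m ∈ Finset.Icc 1 ⌊y⌋₊, primeLogDiv m * cutWeight Q y (m * m))|
      ≤ 2 * K * T + 2 * K * (Real.log (1 + Real.log q) + C₂) := by
    rw [hD, ← Finset.sum_sub_distrib, ← Finset.sum_sub_distrib]
    refine (Finset.abs_sum_le_sum_abs _ _).trans ?_
    refine (Finset.sum_le_sum fun m hm =>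
      abs_diagonal_term_sub_le hK hK0 hy q (Finset.mem_Icc.1 hm).1).trans ?_
    rw [Finset.sum_add_distrib, ← Finset.mul_sum, ← Finset.mul_sum]
    have e1 := summable_vonMangoldt_nonprime.sum_le_tsum (Finset.Icc 1 ⌊y⌋₊) (fun n _ => hnn n)
    have e2 : ∑ m ∈ Finset.Icc 1 ⌊y⌋₊, (if m ∣ q then primeLogDiv m else 0)
        ≤ ∑ p ∈ q.divisors, primeLogDiv p := by
      rw [← Finset.sum_filter]
      refine Finset.sum_le_sum_of_subset_of_nonneg ?_ fun p _ _ => primeLogDiv_nonneg p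
      intro p hp
      exact Nat.mem_divisors.2 ⟨(Finset.mem_filter.1 hp).2, by omega⟩
    exact add_le_add (mul_le_mul_of_nonneg_left e1 (by positivity))
      (mul_le_mul_of_nonneg_left (e2.trans (hC₂ q hq)) (by positivity))
  rw [sum_primeLogDiv_cutWeight Q hy, sum_primeLogDiv_cutWeight_sq Q hy] at h1
  have h2 := hC₁ y hy
  -- The two prime sums have main terms `log y · Q₁(1)` and `(log y / 2) · Q₁(1)`, and the
  -- difference is half the first.
  have h3 := hC₁ (√y) (by rw [Real.lt_sqrt (by norm_num)]; simpa using hy)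
  have hls : Real.log √y = Real.log y / 2 := Real.log_sqrt (by linarith)
  have hpos1 : 0 ≤ 2 * K * T * Real.log (1 + Real.log q) := by positivity
  have hpos2 : 0 ≤ 2 * K * C₂ * Real.log (1 + Real.log q) := by positivity
  have hpos3 : 0 ≤ C₁ * Real.log (1 + Real.log q) := by positivity
  set A := ∑ k ∈ Finset.Icc 0 ⌊y⌋₊, Q.eval ((Real.log y - Real.log k) / Real.log y)
          * primeLogDiv k
  set B := ∑ k ∈ Finset.Icc 0 ⌊√y⌋₊, Q.eval ((Real.log √y - Real.log k) / Real.log √y)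
          * primeLogDiv k
  rw [hls] at h3
  rw [abs_le] at h1 h2 h3 ⊢
  constructor <;> nlinarith [h1.1, h1.2, h2.1, h2.2, h3.1, h3.2]

/-! ### The two pieces as twisted sums and the final estimates -/

/-- The coefficients of the first piece. -/
noncomputable def coeff₁ (P : ℝ[X]) (y : ℝ) (p : ℕ × ℕ) : ℂ :=
  if p.1 = 1 then (ArithmeticFunction.moebius p.2 : ℂ) * (weight P y p.2 : ℂ) else 0

/-- The coefficients of the second piece. -/
noncomputable def coeff₂ (Q : ℝ[X]) (L y : ℝ) (p : ℕ × ℕ) : ℂ :=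
  ((1 / L * (logConvMu p.1 * (ArithmeticFunction.moebius p.2 : ℝ) * weight Q y (p.1 * p.2)) : ℝ) : ℂ)

lemma psi₁_eq_twisted {ϑ : ℝ} {P : ℝ[X]} {q : ℕ} (hY : 1 ≤ ⌊(q : ℝ) ^ ϑ⌋₊)
    (χ : DirichletCharacter ℂ q) :
    psi₁ ϑ P q χ = twisted (coeff₁ P ((q : ℝ) ^ ϑ)) ⌊(q : ℝ) ^ ϑ⌋₊ χ := by
  rw [twisted, sum_pairs _ fun m n => coeff₁ P ((q : ℝ) ^ ϑ) (m, n) * conj (χ m) * χ n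
    / (√((m * n : ℕ) : ℝ) : ℂ), Finset.sum_eq_single 1]
  · rw [Nat.div_one, psi₁]
    refine Finset.sum_congr rfl fun n _ => ?_
    simp only [coeff₁, if_true, Nat.cast_one, map_one, mul_one, one_mul]
    ring
  · intro m _ hm
    exact Finset.sum_eq_zero fun n _ => by simp [coeff₁, hm]
  · intro h
    exact absurd (Finset.mem_Icc.2 ⟨le_rfl, hY⟩) h

lemma psi₂_eq_twisted (ϑ : ℝ) (Q : ℝ[X]) (q : ℕ) (χ : DirichletCharacter ℂ q) :
    psi₂ ϑ Q q χ = twisted (coeff₂ Q (Real.log q) ((q : ℝ) ^ ϑ)) ⌊(q : ℝ) ^ ϑ⌋₊ χ := by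
  rw [psi₂, twisted, Finset.mul_sum, pairs]
  refine Finset.sum_congr rfl fun p _ => ?_
  rw [coeff₂]
  push_cast
  ring

lemma S₁_psi (ϑ₁ ϑ₂ : ℝ) (P Q : ℝ[X]) (q : ℕ) [NeZero q] :
    S₁ q (psi ϑ₁ ϑ₂ P Q q) = S₁ q (psi₁ ϑ₁ P q) + S₁ q (psi₂ ϑ₂ Q q) := by
  simp only [S₁, psi, mul_add, Finset.sum_add_distrib]

lemma norm_moebius_le (n : ℕ) : ‖(ArithmeticFunction.moebius n : ℂ)‖ ≤ 1 := by
  rw [Complex.norm_intCast]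
  exact_mod_cast ArithmeticFunction.abs_moebius_le_one

lemma norm_coeff₁_le {P : ℝ[X]} {K : ℝ} (hK0 : 0 ≤ K)
    (hK : ∀ u ∈ Set.Icc (0 : ℝ) 1, |P.eval u| ≤ K) {y : ℝ} (hy : 1 < y)
    {p : ℕ × ℕ} (hp : p ∈ pairs ⌊y⌋₊) : ‖coeff₁ P y p‖ ≤ K := by
  obtain ⟨h1, h2, h3⟩ := mem_pairs.1 hp
  rw [coeff₁]
  split_ifs with h
  · rw [norm_mul, Complex.norm_real, Real.norm_eq_abs]
    calc _ ≤ 1 * K := by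
          gcongr
          · exact norm_moebius_le _
          · exact abs_weight_le hK hy h2 (by rwa [h, one_mul] at h3)
      _ = K := one_mul K
  · simpa using hK0

/-- The bound `Λ(m) ≤ log m ≤ log q` is compensated exactly by the normalisation `1/L`, so the
coefficients are bounded independently of `q`. -/
lemma norm_coeff₂_le {Q : ℝ[X]} {K : ℝ}
    (hK : ∀ u ∈ Set.Icc (0 : ℝ) 1, |Q.eval u| ≤ K) {q : ℕ} (hq : 2 ≤ q) {y : ℝ} (hy : 1 < y)
    (hyq : ⌊y⌋₊ ≤ q) {p : ℕ × ℕ} (hp : p ∈ pairs ⌊y⌋₊) : ‖coeff₂ Q (Real.log q) y p‖ ≤ K := by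
  obtain ⟨h1, h2, h3⟩ := mem_pairs.1 hp
  have hL : 0 < Real.log q := Real.log_pos (by exact_mod_cast hq)
  rw [coeff₂, Complex.norm_real, Real.norm_eq_abs, abs_mul, abs_mul, abs_mul,
    abs_of_pos (one_div_pos.2 hL), logConvMu_eq,
    abs_of_nonneg ArithmeticFunction.vonMangoldt_nonneg]
  have hv : ArithmeticFunction.vonMangoldt p.1 ≤ Real.log q := by
    refine ArithmeticFunction.vonMangoldt_le_log.trans
      (Real.log_le_log (by exact_mod_cast h1) ?_)
    exact_mod_cast (Nat.le_mul_of_pos_right p.1 h2).trans (h3.trans hyq)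
  have hmu : |(ArithmeticFunction.moebius p.2 : ℝ)| ≤ 1 := by
    exact_mod_cast ArithmeticFunction.abs_moebius_le_one
  calc _ ≤ 1 / Real.log q * (Real.log q * 1 * K) := by
        gcongr
        exact abs_weight_le hK hy (Nat.mul_pos h1 h2) h3
    _ = K := by field_simp

lemma diagonal_coeff₁ {P : ℝ[X]} {y : ℝ} (hy : 1 < y) (q : ℕ) :
    ∑ p ∈ (pairs ⌊y⌋₊).filter (fun p => p.2 ∣ p.1 ∧ p.1.Coprime q), coeff₁ P y p / (p.1 : ℂ)
      = ((P.eval 1 : ℝ) : ℂ) := by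
  have hY : 1 ≤ ⌊y⌋₊ := (Nat.one_le_floor_iff y).2 hy.le
  rw [Finset.sum_eq_single (1, 1)]
  · have := (Real.log_pos hy).ne'
    simp [coeff₁, weight, this]
  · rintro ⟨m, n⟩ hp hne
    rw [coeff₁, if_neg, zero_div]
    rintro h
    simp only at h
    subst h
    have := (Finset.mem_filter.1 hp).2.1
    simp only [Nat.dvd_one] at this
    exact hne (by rw [this])
  · intro h
    refine absurd (Finset.mem_filter.2 ⟨mem_pairs.2 ⟨le_rfl, le_rfl, by simpa using hY⟩, ?_⟩) h
    simp

lemma diagonal_coeff₂ (Q : ℝ[X]) (L y : ℝ) (q : ℕ) :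
    ∑ p ∈ (pairs ⌊y⌋₊).filter (fun p => p.2 ∣ p.1 ∧ p.1.Coprime q), coeff₂ Q L y p / (p.1 : ℂ)
      = ((1 / L * ∑ p ∈ (pairs ⌊y⌋₊).filter (fun p => p.2 ∣ p.1 ∧ p.1.Coprime q),
        logConvMu p.1 * (ArithmeticFunction.moebius p.2 : ℝ) * weight Q y (p.1 * p.2) / (p.1 : ℝ) :
        ℝ) : ℂ) := by
  rw [Finset.mul_sum, Complex.ofReal_sum]
  refine Finset.sum_congr rfl fun p _ => ?_
  rw [coeff₂]
  push_cast
  ring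

lemma log_two_le_log {q : ℕ} (hq : 2 ≤ q) : Real.log 2 ≤ Real.log q :=
  Real.log_le_log (by norm_num) (by exact_mod_cast hq)

/-- This absorbs the `log log q` loss into `L^ε`. The lower bound `log 2` is needed because `L` may
be less than `1`. -/
lemma exists_one_add_log_le {ε : ℝ} (hε : 0 < ε) :
    ∃ C : ℝ, 0 ≤ C ∧ ∀ L : ℝ, Real.log 2 ≤ L → 1 + Real.log (1 + L) ≤ C * L ^ ε := by
  have h2 : 0 < Real.log 2 := Real.log_pos (by norm_num)
  refine ⟨1 / Real.log 2 ^ ε + (1 + 1 / Real.log 2) ^ ε / ε, by positivity, fun L hL => ?_⟩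
  have hL0 : 0 < L := h2.trans_le hL
  have h1 : (1 : ℝ) ≤ 1 / Real.log 2 ^ ε * L ^ ε := by
    rw [one_div_mul_eq_div, le_div_iff₀ (by positivity), one_mul]
    gcongr
  have h3 : Real.log (1 + L) ≤ (1 + 1 / Real.log 2) ^ ε / ε * L ^ ε := by
    have h4 : 1 + L ≤ (1 + 1 / Real.log 2) * L := by
      have : 1 ≤ 1 / Real.log 2 * L := by
        rw [one_div_mul_eq_div, le_div_iff₀ h2, one_mul]; exact hL
      linarith
    calc Real.log (1 + L) ≤ (1 + L) ^ ε / ε := Real.log_le_rpow_div (by linarith) hε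
      _ ≤ ((1 + 1 / Real.log 2) * L) ^ ε / ε := by gcongr
      _ = _ := by rw [Real.mul_rpow (by positivity) hL0.le]; ring
  linarith

lemma exists_rpow_one_sub_le {η ε : ℝ} (hη : 0 < η) (hε : 0 < ε) :
    ∃ C : ℝ, 0 ≤ C ∧ ∀ q : ℕ, 2 ≤ q →
      (q : ℝ) ^ (1 - η) ≤ C * ((q : ℝ) * Real.log q ^ (-1 + ε)) := by
  have h2 : 0 < Real.log 2 := Real.log_pos (by norm_num)
  refine ⟨1 / (η * Real.log 2 ^ ε), by positivity, fun q hq => ?_⟩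
  have hq0 : (0 : ℝ) < q := by exact_mod_cast (by omega : 0 < q)
  have hL : 0 < Real.log q := h2.trans_le (log_two_le_log hq)
  have h1 : Real.log q ≤ (q : ℝ) ^ η / η := Real.log_le_rpow_div hq0.le hη
  have h3 : Real.log 2 ^ ε ≤ Real.log q ^ ε :=
    Real.rpow_le_rpow h2.le (log_two_le_log hq) hε.le
  rw [Real.rpow_sub hq0, Real.rpow_one, Real.rpow_add hL, Real.rpow_neg_one]
  calc (q : ℝ) / (q : ℝ) ^ η ≤ q / (η * Real.log q) := by
        gcongr
        rw [le_div_iff₀ hη] at h1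
        linarith
    _ = q / (η * Real.log q) * 1 := by ring
    _ ≤ q / (η * Real.log q) * (Real.log q ^ ε / Real.log 2 ^ ε) := by
        gcongr
        rw [le_div_iff₀ (by positivity), one_mul]
        exact h3
    _ = _ := by field_simp

lemma one_lt_rpow_of_two_le {q : ℕ} (hq : 2 ≤ q) {ϑ : ℝ} (hϑ : 0 < ϑ) : 1 < (q : ℝ) ^ ϑ :=
  Real.one_lt_rpow (by exact_mod_cast hq) hϑ

lemma floor_rpow_le {q : ℕ} (hq : 2 ≤ q) {ϑ : ℝ} (hϑ : ϑ < 1) : ⌊(q : ℝ) ^ ϑ⌋₊ ≤ q := by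
  refine Nat.floor_le_of_le ?_
  calc (q : ℝ) ^ ϑ ≤ (q : ℝ) ^ (1 : ℝ) :=
        Real.rpow_le_rpow_of_exponent_le (by exact_mod_cast (by omega : 1 ≤ q)) hϑ.le
    _ = q := Real.rpow_one _

lemma exists_norm_S₁_sub_diagonal_le {ϑ ε : ℝ} (hϑ1 : ϑ < 1) (hε : 0 < ε) :
    ∃ C : ℝ, 0 ≤ C ∧ ∀ (q : ℕ) [NeZero q], 2 ≤ q → ∀ (c : ℕ × ℕ → ℂ) (B : ℝ),
      0 ≤ B → (∀ p ∈ pairs ⌊(q : ℝ) ^ ϑ⌋₊, ‖c p‖ ≤ B) →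
      ‖S₁ q (twisted c ⌊(q : ℝ) ^ ϑ⌋₊) - (phiPlus q : ℂ) *
          ∑ p ∈ (pairs ⌊(q : ℝ) ^ ϑ⌋₊).filter (fun p => p.2 ∣ p.1 ∧ p.1.Coprime q),
            c p / (p.1 : ℂ)‖
        ≤ C * B * ((q : ℝ) * Real.log q ^ (-1 + ε)) := by
  -- With this `η` one has `η + (1 + ϑ)/2 = 1 - η`: half of the available saving `(1 - ϑ)/2` pays
  -- for the factor `q^η`, and the rest beats the logarithm.
  have hη : 0 < (1 - ϑ) / 4 := by linarith
  obtain ⟨C₁, hC₁0, hC₁⟩ := exists_norm_S₁_twisted_sub_le hη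
  obtain ⟨C₂, hC₂0, hC₂⟩ := exists_rpow_one_sub_le hη hε
  refine ⟨C₁ * C₂, by positivity, fun q _ hq c B hB hc => ?_⟩
  have hq0 : (0 : ℝ) < q := by exact_mod_cast (by omega : 0 < q)
  refine (hC₁ q hq _ (floor_rpow_le hq hϑ1) c B hB hc).trans ?_
  have hsqrt : √((q * ⌊(q : ℝ) ^ ϑ⌋₊ : ℕ) : ℝ) ≤ (q : ℝ) ^ ((1 + ϑ) / 2) := by
    calc √((q * ⌊(q : ℝ) ^ ϑ⌋₊ : ℕ) : ℝ) ≤ √((q : ℝ) ^ (1 + ϑ)) := by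
          refine Real.sqrt_le_sqrt ?_
          rw [Nat.cast_mul, Real.rpow_add hq0, Real.rpow_one]
          gcongr
          exact Nat.floor_le (by positivity)
      _ = _ := by
          rw [Real.sqrt_eq_rpow, ← Real.rpow_mul hq0.le]
          congr 1
          ring
  calc _ ≤ C₁ * B * (q : ℝ) ^ ((1 - ϑ) / 4) * (q : ℝ) ^ ((1 + ϑ) / 2) := by gcongr
    _ = C₁ * B * (q : ℝ) ^ (1 - (1 - ϑ) / 4) := by
        rw [mul_assoc (C₁ * B), ← Real.rpow_add hq0]
        congr 2
        ring
    _ ≤ C₁ * B * (C₂ * ((q : ℝ) * Real.log q ^ (-1 + ε))) := by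
        gcongr
        exact hC₂ q hq
    _ = _ := by ring

lemma exists_norm_S₁_psi₁_sub_le {ϑ ε : ℝ} (hϑ : 0 < ϑ) (hϑ1 : ϑ < 1) (hε : 0 < ε) (P : ℝ[X]) :
    ∃ C : ℝ, ∀ (q : ℕ) [NeZero q], 2 ≤ q →
      ‖S₁ q (psi₁ ϑ P q) - (phiPlus q : ℂ) * ((P.eval 1 : ℝ) : ℂ)‖
        ≤ C * ((q : ℝ) * Real.log q ^ (-1 + ε)) := by
  obtain ⟨C, hC0, hC⟩ := exists_norm_S₁_sub_diagonal_le hϑ1 hε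
  obtain ⟨K, hK0, hK⟩ := exists_abs_eval_le P
  refine ⟨C * K, fun q _ hq => ?_⟩
  have hy := one_lt_rpow_of_two_le hq hϑ
  have h := hC q hq (coeff₁ P ((q : ℝ) ^ ϑ)) K hK0 fun p hp => norm_coeff₁_le hK0 hK hy hp
  rw [diagonal_coeff₁ hy] at h
  have hpsi : psi₁ ϑ P q = twisted (coeff₁ P ((q : ℝ) ^ ϑ)) ⌊(q : ℝ) ^ ϑ⌋₊ :=
    funext fun χ => psi₁_eq_twisted ((Nat.one_le_floor_iff _).2 hy.le) χ
  rwa [hpsi]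

lemma exists_norm_S₁_psi₂_sub_le {ϑ ε : ℝ} (hϑ : 0 < ϑ) (hϑ1 : ϑ < 1) (hε : 0 < ε) (Q : ℝ[X])
    (hQ : Q.eval 0 = 0) :
    ∃ C : ℝ, ∀ (q : ℕ) [NeZero q], 2 ≤ q →
      ‖S₁ q (psi₂ ϑ Q q) - (phiPlus q : ℂ) * ((ϑ / 2 * primitiveOf Q 1 : ℝ) : ℂ)‖
        ≤ C * ((q : ℝ) * Real.log q ^ (-1 + ε)) := by
  obtain ⟨C, hC0, hC⟩ := exists_norm_S₁_sub_diagonal_le hϑ1 hε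
  obtain ⟨K, hK0, hK⟩ := exists_abs_eval_le Q
  obtain ⟨C₁, hC₁0, hC₁⟩ := exists_abs_diagonal_sub_le Q hQ
  obtain ⟨C₂, hC₂0, hC₂⟩ := exists_one_add_log_le hε
  refine ⟨C * K + C₁ * C₂ / 2, fun q _ hq => ?_⟩
  have hy := one_lt_rpow_of_two_le hq hϑ
  have hq0 : (0 : ℝ) < q := by exact_mod_cast (by omega : 0 < q)
  have hL : 0 < Real.log q := Real.log_pos (by exact_mod_cast hq)
  have h := hC q hq (coeff₂ Q (Real.log q) ((q : ℝ) ^ ϑ)) K hK0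
    fun p hp => norm_coeff₂_le hK hq hy (floor_rpow_le hq hϑ1) hp
  rw [diagonal_coeff₂] at h
  have hpsi : psi₂ ϑ Q q = twisted (coeff₂ Q (Real.log q) ((q : ℝ) ^ ϑ)) ⌊(q : ℝ) ^ ϑ⌋₊ :=
    funext fun χ => psi₂_eq_twisted ϑ Q q χ
  rw [hpsi]
  have hd := hC₁ ((q : ℝ) ^ ϑ) q hy hq
  rw [Real.log_rpow hq0] at hd
  set D := ∑ p ∈ (pairs ⌊(q : ℝ) ^ ϑ⌋₊).filter (fun p => p.2 ∣ p.1 ∧ p.1.Coprime q),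
    logConvMu p.1 * (ArithmeticFunction.moebius p.2 : ℝ) * weight Q ((q : ℝ) ^ ϑ) (p.1 * p.2)
      / (p.1 : ℝ)
  have hphi : |phiPlus q| ≤ q / 2 := by
    rw [phiPlus, abs_div, abs_two]
    gcongr
    exact abs_phiStar_le q
  have hdiag : ‖(phiPlus q : ℂ) * ((1 / Real.log q * D : ℝ) : ℂ)
      - (phiPlus q : ℂ) * ((ϑ / 2 * primitiveOf Q 1 : ℝ) : ℂ)‖
      ≤ C₁ * C₂ / 2 * ((q : ℝ) * Real.log q ^ (-1 + ε)) := by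
    -- As `log y = ϑ L`, division by `L` leaves the constant `ϑ/2` and an error `O((1 + log(1 +
    -- L))/L)`. This dominates the power-saving terms.
    have heq : 1 / Real.log q * D - ϑ / 2 * primitiveOf Q 1
        = 1 / Real.log q * (D - ϑ * Real.log q / 2 * primitiveOf Q 1) := by
      field_simp
    rw [← mul_sub, ← Complex.ofReal_sub, norm_mul, Complex.norm_real, Complex.norm_real,
      Real.norm_eq_abs, Real.norm_eq_abs, heq, abs_mul, abs_of_pos (one_div_pos.2 hL)]
    calc _ ≤ q / 2 * (1 / Real.log q * (C₁ * (C₂ * Real.log q ^ ε))) := by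
          gcongr
          refine hd.trans ?_
          gcongr
          exact hC₂ _ (log_two_le_log hq)
      _ = _ := by
          rw [Real.rpow_add hL, Real.rpow_neg_one]
          ring
  refine (norm_sub_le_norm_sub_add_norm_sub _ _ _).trans ((add_le_add h hdiag).trans (le_of_eq ?_))
  ring

end TwoPieceMollifier

theorem theorem2p1 (ϑ₁ ϑ₂ : ℝ) (hϑ₁ : 0 < ϑ₁) (hϑ₁' : ϑ₁ < 1) (hϑ₂ : 0 < ϑ₂) (hϑ₂' : ϑ₂ < 1)
    (P Q : ℝ[X]) (hP : P.eval 0 = 0) (hQ : Q.eval 0 = 0) (ε : ℝ) (hε : 0 < ε) :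
    ∃ C : ℝ, ∀ (q : ℕ) [NeZero q], 2 ≤ q →
      ‖TwoPieceMollifier.S₁ q (TwoPieceMollifier.psi ϑ₁ ϑ₂ P Q q)
          - ((TwoPieceMollifier.phiPlus q
              * (P.eval 1 + ϑ₂ / 2 * TwoPieceMollifier.primitiveOf Q 1) : ℝ) : ℂ)‖
        ≤ C * ((q : ℝ) * Real.log q ^ (-1 + ε)) := by
  obtain ⟨C₁, hC₁⟩ := TwoPieceMollifier.exists_norm_S₁_psi₁_sub_le hϑ₁ hϑ₁' hε P
  obtain ⟨C₂, hC₂⟩ := TwoPieceMollifier.exists_norm_S₁_psi₂_sub_le hϑ₂ hϑ₂' hε Q hQ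
  refine ⟨C₁ + C₂, fun q _ hq => ?_⟩
  rw [TwoPieceMollifier.S₁_psi, Complex.ofReal_mul, Complex.ofReal_add, mul_add,
    add_sub_add_comm, add_mul]
  exact (norm_add_le _ _).trans (add_le_add (hC₁ q hq) (hC₂ q hq))
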